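/- **Setting.** Let $f:\mathbb R^N\to\mathbb R$ and $c:\mathbb R^N\to\mathbb R^M$ be twice continuously differentiable, $g=\nabla f$, $J$ the Jacobian of $c$, and $\|\cdot\|$ the Euclidean norm. Put $r(x,t)=(c(x),f(x)-t)$ and $\Phi(x,t)=\tfrac12\|r(x,t)\|^2$. TRACE uses parameters $\eta,\gamma_C\in(0,1)$, $\gamma_E,\gamma_\lambda\in(1,\infty)$, $0<\underline\sigma\le\overline\sigma<\infty$. **Method.** Given $\epsilon>0$, $\epsilon_{feas}\in(0,1)$, $x_0$ with $\|c(x_0)\|\le\epsilon_{feas}$, $0<\delta_0\le\Delta_0$ and $\sigma_0\ge\underline\sigma$, set $t_0=f(x_0)-\sqrt{\epsilon_{feas}^2-\|c(x_0)\|^2}$. For $k=0,1,2,\dots$ write $\psi_k=\Phi(\cdot,t_k)$, $g_k^\psi=\nabla\psi_k(x_k)$, $H_k^\psi=\nabla^2\psi_k(x_k)$. If $g_k^\psi=0$, stop. Let $s_k$ be a global minimizer of the model $m_k(s)=\psi_k(x_k)+s^Tg_k^\psi+\tfrac12 s^TH_k^\psi s$ over $\|s\|\le\delta_k$, with multiplier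 $\lambda_k\ge0$, that is, $g_k^\psi+(H_k^\psi+\lambda_kI)s_k=0$, $H_k^\psi+\lambda_kI\succeq0$, $\lambda_k(\delta_k-\|s_k\|)=0$. Let $\rho_k=(\psi_k(x_k)-\psi_k(x_k+s_k))/\|s_k\|^3$. * *Accept*, if $\rho_k\ge\eta$ and either $\lambda_k\le\sigma_k\|s_k\|$ or $\|s_k\|=\Delta_k$: set $x_{k+1}=x_k+s_k$. If $r(x_{k+1},t_k)\ne0$ and $\|\nabla_x\Phi(x_{k+1},t_k)\|\le\epsilon\|r(x_{k+1},t_k)\|$ (the *termination test*), terminate. Otherwise set $$t_{k+1}=f(x_{k+1})-\sqrt{\|r(x_k,t_k)\|^2-\|r(x_{k+1},t_k)\|^2+(f(x_{k+1})-t_k)^2},$$ $\Delta_{k+1}=\max\{\Delta_k,\gamma_E\|s_k\|\}$, $\delta_{k+1}=\min\{\Delta_{k+1},\max\{\delta_k,\gamma_E\|s_k\|\}\}$, $\sigma_{k+1}=\max\{\sigma_k,\lambda_k/\|s_k\|\}$. * *Contract*, if $\rho_k<\eta$: keep $x,t,\Delta$. With $s(\lambda)$ denoting the minimizer of $m_k(s)+\tfrac\lambda2\|s\|^2$: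 if $\lambda_k<\underline\sigma\|s_k\|$, let $\hat\lambda=\lambda_k+(\underline\sigma\|g_k^\psi\|)^{1/2}$ and set $\delta_{k+1}=\|s(\hat\lambda)\|$ if $\hat\lambda/\|s(\hat\lambda)\|\le\overline\sigma$, and otherwise $\delta_{k+1}=\|s(\lambda)\|$ for some $\lambda\in(\lambda_k,\hat\lambda)$ with $\underline\sigma\le\lambda/\|s(\lambda)\|\le\overline\sigma$; if $\lambda_k\ge\underline\sigma\|s_k\|$, set $\delta_{k+1}=\max\{\|s(\gamma_\lambda\lambda_k)\|,\gamma_C\|s_k\|\}$. Then $\sigma_{k+1}=\max\{\sigma_k,\lambda_{k+1}/\|s_{k+1}\|\}$. * *Expand*, otherwise: keep $x,t,\Delta,\sigma$ and set $\delta_{k+1}=\min\{\Delta_{k+1},\lambda_k/\sigma_k\}$. **Assumptions.** $f_{\min}\le f(x)\le f_{\max}$ for all $x$ with $\|c(x)\|\le\epsilon_{feas}$. Moreover $f$, $c$ and their first and second derivatives are Lipschitz with constant $L$ along all segments $[x_k,x_k+s_k]$ of the iterations performed; here $F$ is Lipschitz with constant $L$ along a segment if for each of its points $x$ one has $\|F(y)-F(x)\|\le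 L\|y-x\|$ for all $y\in\mathbb R^N$ close enough to $x$ (this holds, for instance, if $F$ is $L$-Lipschitz on an open set containing the segment). **Theorem.** There is a constant $C$, depending only on the TRACE parameters, $L$, $f_{\min}$, $f_{\max}$, $\Delta_0$ and $\sigma_0$, such that if $\epsilon\le\epsilon_{feas}^{1/3}$ and $\epsilon_{feas}<1$, then every sequence generated by the method stops within at most $C\,\epsilon^{-3/2}\epsilon_{feas}^{-1/2}$ iterations. It stops either because the termination test holds at $(\hat x,\hat t)=(x_{k+1},t_k)$ after an accepted step $s_k$, or at an exact stationary point, $\nabla_x\Phi(\hat x,\hat t)=0$ with $(\hat x,\hat t)=(x_k,t_k)$. In both cases either $$f(\hat x)\ne\hat t,\quad \frac{\|J(\hat x)^T\hat y+g(\hat x)\|}{\|(\hat y,1)\|}\le\epsilon\ \text{ with }\ \hat y=\frac{c(\hat x)}{f(\hat x)-\hat t},\quad\text{and}\quad \|c(\hat x)\|\le\epsilon_{feas},$$ or $$c(\hat x)\ne0,\quad \frac{\|J(\hat x)^Tc(\hat x)\|}{\|c(\hat x)\|}\le\epsilon,\quad\text{and}\quad \|c(\hat x)\|\le\epsilon_{feas}.$$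 -/

import Mathlib

open scoped NNReal Topology Gradient InnerProductSpace

noncomputable section

/-! ### The trust region method TRACE for a smooth objective `ψ` -/

/-- The parameters of TRACE: acceptance constant `η`, update constants `γC`, `γE`, `γlam`
and ratio bounds `σlo ≤ σhi`. -/
structure TraceParams where
  η : ℝ
  γC : ℝ
  γE : ℝ
  γlam : ℝ
  σlo : ℝ
  σhi : ℝ
  η_pos : 0 < η
  η_lt_one : η < 1
  γC_pos : 0 < γC
  γC_lt_one : γC < 1
  one_lt_γE : 1 < γE
  one_lt_γlam : 1 < γlam
  σlo_pos : 0 < σlo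
  σlo_le_σhi : σlo ≤ σhi

/-- The Hessian of `ψ` at `x`, as a linear operator. -/
def hess {N : ℕ} (ψ : EuclideanSpace ℝ (Fin N) → ℝ) (x : EuclideanSpace ℝ (Fin N)) :
    EuclideanSpace ℝ (Fin N) →L[ℝ] EuclideanSpace ℝ (Fin N) :=
  fderiv ℝ (∇ ψ) x

/-- The second-order Taylor model of `ψ` at `x`. -/
def quadModel {N : ℕ} (ψ : EuclideanSpace ℝ (Fin N) → ℝ) (x s : EuclideanSpace ℝ (Fin N)) : ℝ :=
  ψ x + ⟪∇ ψ x, s⟫_ℝ + (1 / 2) * ⟪s, hess ψ x s⟫_ℝ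

/-- `(s, lam)` is a primal-dual solution of the trust region subproblem
`min quadModel ψ x s` subject to `‖s‖ ≤ δ`: `s` is a global minimizer and `lam` is its
multiplier. -/
structure IsTRSolution {N : ℕ} (ψ : EuclideanSpace ℝ (Fin N) → ℝ)
    (x : EuclideanSpace ℝ (Fin N)) (δ : ℝ) (s : EuclideanSpace ℝ (Fin N)) (lam : ℝ) : Prop where
  norm_le : ‖s‖ ≤ δ
  isMin : ∀ u : EuclideanSpace ℝ (Fin N), ‖u‖ ≤ δ → quadModel ψ x s ≤ quadModel ψ x u
  dual : ∇ ψ x + (hess ψ x s + lam • s) = 0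
  psd : ∀ u : EuclideanSpace ℝ (Fin N), 0 ≤ ⟪u, hess ψ x u + lam • u⟫_ℝ
  lam_nonneg : 0 ≤ lam
  compl : lam * (δ - ‖s‖) = 0

/-- `s` solves the regularized subproblem: minimize `quadModel ψ x s + (μ / 2) ‖s‖ ^ 2`
over all `s`. -/
def IsRegSolution {N : ℕ} (ψ : EuclideanSpace ℝ (Fin N) → ℝ)
    (x : EuclideanSpace ℝ (Fin N)) (μ : ℝ) (s : EuclideanSpace ℝ (Fin N)) : Prop :=
  ∀ u : EuclideanSpace ℝ (Fin N),
    quadModel ψ x s + μ / 2 * ‖s‖ ^ 2 ≤ quadModel ψ x u + μ / 2 * ‖u‖ ^ 2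

/-- The ratio of actual decrease to `‖s‖ ^ 3`. -/
def decreaseRatio {N : ℕ} (ψ : EuclideanSpace ℝ (Fin N) → ℝ)
    (x s : EuclideanSpace ℝ (Fin N)) : ℝ :=
  (ψ x - ψ (x + s)) / ‖s‖ ^ 3

/-- The procedure CONTRACT may return the radius `δnew` when it is called at `x` with trial
step `s` and multiplier `lam`. -/
def Contract {N : ℕ} (P : TraceParams) (ψ : EuclideanSpace ℝ (Fin N) → ℝ)
    (x s : EuclideanSpace ℝ (Fin N)) (lam δnew : ℝ) : Prop :=
  (lam < P.σlo * ‖s‖ ∧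
    ∃ lamHat : ℝ, lamHat = lam + Real.sqrt (P.σlo * ‖∇ ψ x‖) ∧
      ∃ sHat : EuclideanSpace ℝ (Fin N), IsRegSolution ψ x lamHat sHat ∧
        ((lamHat / ‖sHat‖ ≤ P.σhi ∧ δnew = ‖sHat‖) ∨
         (P.σhi < lamHat / ‖sHat‖ ∧
           ∃ μ : ℝ, lam < μ ∧ μ < lamHat ∧
             ∃ u : EuclideanSpace ℝ (Fin N), IsRegSolution ψ x μ u ∧
               P.σlo ≤ μ / ‖u‖ ∧ μ / ‖u‖ ≤ P.σhi ∧ δnew = ‖u‖))) ∨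
  (P.σlo * ‖s‖ ≤ lam ∧
    ∃ u : EuclideanSpace ℝ (Fin N), IsRegSolution ψ x (P.γlam * lam) u ∧
      δnew = if P.γC * ‖s‖ ≤ ‖u‖ then ‖u‖ else P.γC * ‖s‖)

/-! ### The residual -/

/-- The residual `r(x, t) = (c(x), f(x) - t)`, with the Euclidean norm. -/
def resid {N M : ℕ} (f : EuclideanSpace ℝ (Fin N) → ℝ)
    (c : EuclideanSpace ℝ (Fin N) → EuclideanSpace ℝ (Fin M))
    (x : EuclideanSpace ℝ (Fin N)) (t : ℝ) : WithLp 2 (EuclideanSpace ℝ (Fin M) × ℝ) :=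
  WithLp.toLp 2 (c x, f x - t)

/-- `Φ(·, t) = ½ ‖r(·, t)‖ ^ 2`. -/
def residObj {N M : ℕ} (f : EuclideanSpace ℝ (Fin N) → ℝ)
    (c : EuclideanSpace ℝ (Fin N) → EuclideanSpace ℝ (Fin M)) (t : ℝ)
    (x : EuclideanSpace ℝ (Fin N)) : ℝ :=
  (1 / 2) * ‖resid f c x t‖ ^ 2

/-! ### The phase 2 method -/

/-- The quantities held at the start of an iteration: iterate `x`, target `t`, trust region
radius `δ`, its upper bound `Δ`, ratio bound `σ`, and the trial step `s` with its
multiplier `lam`. -/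
structure PhaseState (N : ℕ) where
  x : EuclideanSpace ℝ (Fin N)
  t : ℝ
  δ : ℝ
  Δ : ℝ
  σ : ℝ
  s : EuclideanSpace ℝ (Fin N)
  lam : ℝ

section Phase2

variable {N M : ℕ} (P : TraceParams) (f : EuclideanSpace ℝ (Fin N) → ℝ)
  (c : EuclideanSpace ℝ (Fin N) → EuclideanSpace ℝ (Fin M))

/-- The stored `(s, lam)` is a primal-dual solution of the subproblem for `Φ(·, t)` at `x`
with radius `δ`. -/
def SolvesSubproblem (z : PhaseState N) : Prop :=
  IsTRSolution (residObj f c z.t) z.x z.δ z.s z.lam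

/-- The initial state for `x₀` and the radii and ratio bound `δ₀`, `Δ₀`, `σ₀`. -/
def IsInitial (εfeas : ℝ) (x₀ : EuclideanSpace ℝ (Fin N)) (δ₀ Δ₀ σ₀ : ℝ)
    (z : PhaseState N) : Prop :=
  z.x = x₀ ∧ z.t = f x₀ - Real.sqrt (εfeas ^ 2 - ‖c x₀‖ ^ 2) ∧
    z.δ = δ₀ ∧ z.Δ = Δ₀ ∧ z.σ = σ₀ ∧ SolvesSubproblem f c z

/-- The acceptance ratio of the trial step. -/
def stepRatio (z : PhaseState N) : ℝ :=
  decreaseRatio (residObj f c z.t) z.x z.s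

/-- The trial step is acceptable. -/
def Accepted (z : PhaseState N) : Prop :=
  P.η ≤ stepRatio f c z ∧ (z.lam ≤ z.σ * ‖z.s‖ ∨ ‖z.s‖ = z.Δ)

/-- The termination test at a point `x` with target `t`. -/
def TerminationTest (ε : ℝ) (x : EuclideanSpace ℝ (Fin N)) (t : ℝ) : Prop :=
  resid f c x t ≠ 0 ∧ ‖∇ (residObj f c t) x‖ ≤ ε * ‖resid f c x t‖

/-- The current iterate is an exact stationary point of `Φ(·, t)`. TRACE performs no iteration
from such a point. -/
def AtStationary (z : PhaseState N) : Prop :=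
  ∇ (residObj f c z.t) z.x = 0

/-- The method stops in state `z`, by the termination test after an accepted step or because
the current iterate is stationary. -/
def Halts (ε : ℝ) (z : PhaseState N) : Prop :=
  AtStationary f c z ∨
    (Accepted P f c z ∧ TerminationTest f c ε (z.x + z.s) z.t)

/-- The target that follows an accepted step. -/
def nextTarget (z : PhaseState N) : ℝ :=
  f (z.x + z.s) - Real.sqrt (‖resid f c z.x z.t‖ ^ 2 - ‖resid f c (z.x + z.s) z.t‖ ^ 2
    + (f (z.x + z.s) - z.t) ^ 2)

/-- One iteration of the phase 2 method that does not end in termination takes state `z` to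
state `w`: an accepted step, a contraction, or an expansion. -/
def PhaseStep (z w : PhaseState N) : Prop :=
  SolvesSubproblem f c w ∧
  ((Accepted P f c z ∧
      w.x = z.x + z.s ∧ w.t = nextTarget f c z ∧
      w.Δ = max z.Δ (P.γE * ‖z.s‖) ∧
      w.δ = min w.Δ (max z.δ (P.γE * ‖z.s‖)) ∧
      w.σ = max z.σ (z.lam / ‖z.s‖)) ∨
   (stepRatio f c z < P.η ∧
      w.x = z.x ∧ w.t = z.t ∧ w.Δ = z.Δ ∧
      Contract P (residObj f c z.t) z.x z.s z.lam w.δ ∧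
      w.σ = max z.σ (w.lam / ‖w.s‖)) ∨
   (P.η ≤ stepRatio f c z ∧ ¬ Accepted P f c z ∧
      w.x = z.x ∧ w.t = z.t ∧ w.Δ = z.Δ ∧
      w.δ = min w.Δ (z.lam / z.σ) ∧
      w.σ = z.σ))

/-- `z 0, z 1, …` is a run of the phase 2 method: it starts in an initial state, and an
iteration is performed as long as the method has not stopped. The entries after the
stopping state are irrelevant. -/
def IsPhaseRun (ε εfeas : ℝ) (x₀ : EuclideanSpace ℝ (Fin N)) (δ₀ Δ₀ σ₀ : ℝ)
    (z : ℕ → PhaseState N) : Prop :=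
  IsInitial f c εfeas x₀ δ₀ Δ₀ σ₀ (z 0) ∧
    ∀ k : ℕ, (∀ j ≤ k, ¬ Halts P f c ε (z j)) → PhaseStep P f c (z k) (z (k + 1))

/-- The relative KKT error at `(x, y)`, with `y = c(x) / (f(x) - t)`, is at most `ε`. -/
def RelativeKKT (ε : ℝ) (x : EuclideanSpace ℝ (Fin N)) (t : ℝ) : Prop :=
  f x ≠ t ∧
    ∃ y : EuclideanSpace ℝ (Fin M), y = (f x - t)⁻¹ • c x ∧
      ‖ContinuousLinearMap.adjoint (fderiv ℝ c x) y + ∇ f x‖ /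
        ‖(WithLp.toLp 2 (y, (1 : ℝ)) : WithLp 2 (EuclideanSpace ℝ (Fin M) × ℝ))‖ ≤ ε

/-- `x` is an approximate first-order stationary point of `‖c‖` with `c(x) ≠ 0`. -/
def FeasStationary (ε : ℝ) (x : EuclideanSpace ℝ (Fin N)) : Prop :=
  c x ≠ 0 ∧ ‖ContinuousLinearMap.adjoint (fderiv ℝ c x) (c x)‖ / ‖c x‖ ≤ ε

/-- The guarantee for the point at which the method stops. -/
def ApproxSolution (ε εfeas : ℝ) (x : EuclideanSpace ℝ (Fin N)) (t : ℝ) : Prop :=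
  (RelativeKKT f c ε x t ∧ ‖c x‖ ≤ εfeas) ∨ (FeasStationary c ε x ∧ ‖c x‖ ≤ εfeas)

end Phase2

/-! ### Lipschitz continuity along a path -/

/-- `F` is Lipschitz with constant `L` at all points of `S`, for perturbations in the whole
space and not only along `S`. On a segment `S` this implies that `F` is `L`-Lipschitz on `S`;
it holds whenever `F` is `L`-Lipschitz on some open set that contains `S`. -/
def LipschitzAlong {E G : Type*} [NormedAddCommGroup E] [NormedAddCommGroup G]
    (L : ℝ≥0) (F : E → G) (S : Set E) : Prop :=
  ∀ x ∈ S, ∀ᶠ y in 𝓝 x, ‖F y - F x‖ ≤ L * ‖y - x‖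

/-- `F` and its first and second derivatives are Lipschitz with constant `L` along `S`. -/
def LipschitzAlongC2 {E G : Type*} [NormedAddCommGroup E] [NormedSpace ℝ E]
    [NormedAddCommGroup G] [NormedSpace ℝ G] (L : ℝ≥0) (F : E → G) (S : Set E) : Prop :=
  LipschitzAlong L F S ∧ LipschitzAlong L (fderiv ℝ F) S ∧
    LipschitzAlong L (fderiv ℝ (fderiv ℝ F)) S

end

/-! The target update is chosen so that `‖r(x, t)‖ = εfeas` and `t ≤ f x` in every state
(`PhaseStep.runInvariant`). Hence iterates stay nearly feasible, `f` is bounded at them, and `t`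
remains in `[fmin - εfeas, fmax]`. Since the target never increases, it suffices that each
nonterminating accepted step lowers it by a multiple of `ε ^ (3/2) * εfeas ^ (1/2)`, and that
boundedly many other iterations lie between accepted steps.

Decrease per accepted step (`RunInvariant.target_decrease`): acceptance lowers the squared residual
by at least `2η‖s‖³`, and a decrease `D` of the squared residual lowers the target by at least `D /
(2 εfeas)`. If the new residual is at most `εfeas / 2`, then `D` is of order `εfeas²`. Otherwise
either `‖s‖ = Δ ≥ Δ₀`, or `lam ≤ σ‖s‖`; in the latter case the new gradient is `O(‖s‖²)`, while
failure of the termination test makes it larger than `ε εfeas / 2`, so `‖s‖³` is at least of order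
`(ε εfeas) ^ (3/2)`.

Iterations between accepted steps (`SinceAccept.step`): an expansion establishes the second
acceptance condition, and so does the update of `σ` after a contraction. So at most one expansion
occurs, and only before any contraction. The first contraction makes `lam / ‖s‖ ≥ σlo`, and each
further one multiplies this lower bound by a factor above one. By Taylor's theorem a step with ratio
at least `ratioBound` is never contracted. The constants are uniform because `σ` stays below
`sigmaMax` and the derivatives of `Φ` are bounded through `L` and `‖r‖ ≤ 1`.

At the stopping point, `r = (f - t)(y, 1)` and `∇Φ = (f - t)(Jᵀy + g)`, so the relative gradient
bound is the relative KKT bound; if `f = t`, it is the bound for the infeasibility. -/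

noncomputable section

/-! ### Gradient and Hessian through the Riesz isometry -/

section Riesz

variable {N : ℕ}

/-- The inverse of the Riesz isometry, as a real linear isometry. -/
def rieszInv (N : ℕ) : (EuclideanSpace ℝ (Fin N) →L[ℝ] ℝ) →ₗᵢ[ℝ] EuclideanSpace ℝ (Fin N) where
  toFun := (InnerProductSpace.toDual ℝ (EuclideanSpace ℝ (Fin N))).symm
  map_add' := map_add _
  map_smul' a φ := by simp
  norm_map' := (InnerProductSpace.toDual ℝ (EuclideanSpace ℝ (Fin N))).symm.norm_map

theorem inner_rieszInv (φ : EuclideanSpace ℝ (Fin N) →L[ℝ] ℝ) (v : EuclideanSpace ℝ (Fin N)) :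
    ⟪rieszInv N φ, v⟫_ℝ = φ v :=
  InnerProductSpace.toDual_symm_apply

theorem gradient_eq_rieszInv (ψ : EuclideanSpace ℝ (Fin N) → ℝ) (x : EuclideanSpace ℝ (Fin N)) :
    ∇ ψ x = rieszInv N (fderiv ℝ ψ x) := rfl

theorem inner_gradient (ψ : EuclideanSpace ℝ (Fin N) → ℝ) (x v : EuclideanSpace ℝ (Fin N)) :
    ⟪∇ ψ x, v⟫_ℝ = fderiv ℝ ψ x v :=
  inner_rieszInv _ _

theorem norm_gradient (ψ : EuclideanSpace ℝ (Fin N) → ℝ) (x : EuclideanSpace ℝ (Fin N)) :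
    ‖∇ ψ x‖ = ‖fderiv ℝ ψ x‖ :=
  (rieszInv N).norm_map _

variable {ψ : EuclideanSpace ℝ (Fin N) → ℝ}

theorem ContDiff.differentiable_fderiv_two {E G : Type*} [NormedAddCommGroup E] [NormedSpace ℝ E]
    [NormedAddCommGroup G] [NormedSpace ℝ G] {F : E → G} (hF : ContDiff ℝ 2 F) :
    Differentiable ℝ (fderiv ℝ F) :=
  (hF.fderiv_right (m := 1) (by norm_num)).differentiable (by norm_num)

/-- Transport through a linear isometry, so operator-norm estimates for second derivatives carry
over to the Hessian. -/
theorem hess_apply (hψ : ContDiff ℝ 2 ψ) (x u : EuclideanSpace ℝ (Fin N)) :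
    hess ψ x u = rieszInv N (fderiv ℝ (fderiv ℝ ψ) x u) := by
  have h := (rieszInv N).toContinuousLinearMap.hasFDerivAt.comp x
    (hψ.differentiable_fderiv_two x).hasFDerivAt
  have h2 : HasFDerivAt (∇ ψ)
    ((rieszInv N).toContinuousLinearMap ∘L fderiv ℝ (fderiv ℝ ψ) x) x := h
  rw [hess, h2.fderiv]
  rfl

theorem inner_hess (hψ : ContDiff ℝ 2 ψ) (x u v : EuclideanSpace ℝ (Fin N)) :
    ⟪hess ψ x u, v⟫_ℝ = fderiv ℝ (fderiv ℝ ψ) x u v := by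
  rw [hess_apply hψ, inner_rieszInv]

theorem inner_hess_comm (hψ : ContDiff ℝ 2 ψ) (x u v : EuclideanSpace ℝ (Fin N)) :
    ⟪hess ψ x u, v⟫_ℝ = ⟪hess ψ x v, u⟫_ℝ := by
  rw [inner_hess hψ, inner_hess hψ]
  exact (hψ.contDiffAt.isSymmSndFDerivAt (by simp)) u v

end Riesz

/-! ### Trust region and regularized subproblems -/

section Subproblem

variable {N : ℕ} {ψ : EuclideanSpace ℝ (Fin N) → ℝ} {x s u s' : EuclideanSpace ℝ (Fin N)}
  {δ lam lam' μ ν : ℝ}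

/-- Expansion of the regularized model around a point. -/
theorem quadModel_add_smul (hψ : ContDiff ℝ 2 ψ) (x u d : EuclideanSpace ℝ (Fin N)) (μ τ : ℝ) :
    quadModel ψ x (u + τ • d) + μ / 2 * ‖u + τ • d‖ ^ 2 =
      quadModel ψ x u + μ / 2 * ‖u‖ ^ 2 + τ * ⟪∇ ψ x + (hess ψ x u + μ • u), d⟫_ℝ
        + τ ^ 2 / 2 * ⟪d, hess ψ x d + μ • d⟫_ℝ := by
  have h1 := inner_hess_comm hψ x d u
  simp only [quadModel, ← real_inner_self_eq_norm_sq, map_add, map_smul, inner_add_left,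
    inner_add_right, real_inner_smul_left, real_inner_smul_right, real_inner_comm]
  rw [real_inner_comm] at h1
  simp only [real_inner_comm] at h1 ⊢
  linear_combination (τ / 2) * h1

/-- A trust region solution solves the regularized subproblem for its multiplier. -/
theorem IsTRSolution.isRegSolution (hψ : ContDiff ℝ 2 ψ) (h : IsTRSolution ψ x δ s lam) :
    IsRegSolution ψ x lam s := by
  intro u
  have h1 := quadModel_add_smul hψ x s (u - s) lam 1
  rw [h.dual] at h1
  simp only [one_smul, add_sub_cancel, inner_zero_left] at h1
  have := h.psd (u - s)
  rw [h1]
  linarith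

/-- First-order optimality for the regularized subproblem. -/
theorem IsRegSolution.dual (hψ : ContDiff ℝ 2 ψ) (h : IsRegSolution ψ x μ u) :
    ∇ ψ x + (hess ψ x u + μ • u) = 0 := by
  set w := ∇ ψ x + (hess ψ x u + μ • u) with hw
  by_contra hne
  have hpos : 0 < ‖w‖ ^ 2 := by positivity
  set b := ⟪w, hess ψ x w + μ • w⟫_ℝ
  -- A descent step along `-w` this short has quadratic term at most half of the linear gain
  -- `τ‖w‖²`, contradicting minimality.
  set τ : ℝ := ‖w‖ ^ 2 / (|b| + 1) with hτ
  have hτpos : 0 < τ := by positivity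
  have h1 := h (u + (-τ) • w)
  rw [quadModel_add_smul hψ x u w μ (-τ), ← hw, real_inner_self_eq_norm_sq] at h1
  have h2 : τ * (|b| + 1) = ‖w‖ ^ 2 := by rw [hτ]; field_simp
  have h3 : b ≤ |b| := le_abs_self b
  have h4 : 0 ≤ τ * (τ / 2 * b - ‖w‖ ^ 2) := by linarith
  have h5 : 0 ≤ τ / 2 * b - ‖w‖ ^ 2 := by
    by_contra hc
    have := mul_neg_of_pos_of_neg hτpos (not_le.mp hc)
    linarith
  nlinarith [mul_le_mul_of_nonneg_left h3 hτpos.le]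

/-- The norm of a regularized solution is antitone in the regularization parameter. -/
theorem IsRegSolution.mul_sub_nonpos (h : IsRegSolution ψ x μ u) (h' : IsRegSolution ψ x ν s) :
    (μ - ν) * (‖u‖ ^ 2 - ‖s‖ ^ 2) ≤ 0 := by
  linarith [h s, h' u]

theorem IsRegSolution.norm_le_of_lt (h : IsRegSolution ψ x μ u) (h' : IsRegSolution ψ x ν s)
    (hlt : ν < μ) : ‖u‖ ≤ ‖s‖ := by
  by_contra hc
  have h1 := h.mul_sub_nonpos h'
  have : ‖s‖ ^ 2 < ‖u‖ ^ 2 := pow_lt_pow_left₀ (not_le.mp hc) (norm_nonneg _) (by norm_num)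
  nlinarith

theorem IsRegSolution.le_of_norm_lt (h : IsRegSolution ψ x μ u) (h' : IsRegSolution ψ x ν s)
    (hlt : ‖u‖ < ‖s‖) : ν ≤ μ := by
  by_contra hc
  have := h'.norm_le_of_lt h (not_le.mp hc)
  linarith

theorem IsTRSolution.ne_zero (h : IsTRSolution ψ x δ s lam) (hg : ∇ ψ x ≠ 0) : s ≠ 0 := by
  rintro rfl
  exact hg (by simpa using h.dual)

theorem IsTRSolution.norm_eq (h : IsTRSolution ψ x δ s lam) (hl : 0 < lam) : ‖s‖ = δ := by
  rcases mul_eq_zero.mp h.compl with h0 | h0 <;> linarith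

/-- If the radius is the norm of a regularized solution for `μ`, then `μ` is the multiplier. -/
theorem IsTRSolution.eq_of_isRegSolution (hψ : ContDiff ℝ 2 ψ) (hg : ∇ ψ x ≠ 0)
    (h : IsTRSolution ψ x ‖u‖ s lam) (hu : IsRegSolution ψ x μ u) (hμ : 0 < μ) :
    ‖s‖ = ‖u‖ ∧ lam = μ := by
  have h1 := h.isMin u le_rfl
  have h2 := hu s
  have h3 : ‖s‖ ^ 2 ≤ ‖u‖ ^ 2 := pow_le_pow_left₀ (norm_nonneg _) h.norm_le 2
  have h4 : ‖u‖ ^ 2 ≤ ‖s‖ ^ 2 := by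
    by_contra hc
    nlinarith [mul_pos hμ (sub_pos.mpr (not_le.mp hc))]
  have h5 : ‖u‖ ≤ ‖s‖ := le_of_sq_le_sq h4 (norm_nonneg _)
  have h6 : ‖s‖ = ‖u‖ := le_antisymm h.norm_le h5
  refine ⟨h6, ?_⟩
  -- With equal norms, `s` also minimizes the `μ`-regularized model. Subtracting the two
  -- stationarity equations then leaves `(lam - μ) • s = 0`. No uniqueness of minimizers is needed.
  have hs : IsRegSolution ψ x μ s := fun v => by
    have := hu v
    rw [h6]
    linarith
  have h7 := hs.dual hψ
  have h8 := h.dual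
  have h9 : (lam - μ) • s = 0 := by
    rw [sub_smul, sub_eq_zero]
    exact add_left_cancel (add_left_cancel (h8.trans h7.symm))
  rcases smul_eq_zero.mp h9 with h0 | h0
  · linarith
  · exact absurd h0 (h.ne_zero hg)

/-- The decrease in the model that a trust region solution yields. -/
theorem IsTRSolution.model_decrease (h : IsTRSolution ψ x δ s lam) :
    quadModel ψ x s ≤ ψ x - lam / 2 * ‖s‖ ^ 2 := by
  have h1 : ⟪∇ ψ x + (hess ψ x s + lam • s), s⟫_ℝ = 0 := by rw [h.dual, inner_zero_left]
  have h2 := h.psd s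
  rw [real_inner_comm] at h2
  simp only [inner_add_left, real_inner_smul_left, real_inner_self_eq_norm_sq] at h1 h2
  rw [quadModel, real_inner_comm (hess ψ x s) s]
  linarith

/-- A lower bound for the step length ratio at the regularization that CONTRACT tries first. -/
theorem IsRegSolution.mul_norm_le (hψ : ContDiff ℝ 2 ψ) (h : IsTRSolution ψ x δ s lam)
    {σ : ℝ} (hσ : 0 < σ) (hg : ∇ ψ x ≠ 0)
    (hu : IsRegSolution ψ x (lam + Real.sqrt (σ * ‖∇ ψ x‖)) u) :
    σ * ‖u‖ ≤ lam + Real.sqrt (σ * ‖∇ ψ x‖) := by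
  have hgpos : 0 < ‖∇ ψ x‖ := norm_pos_iff.mpr hg
  set ρ := Real.sqrt (σ * ‖∇ ψ x‖) with hρ
  have hρpos : 0 < ρ := Real.sqrt_pos.mpr (mul_pos hσ hgpos)
  have hρsq : ρ ^ 2 = σ * ‖∇ ψ x‖ := Real.sq_sqrt (mul_pos hσ hgpos).le
  have h1 : ⟪∇ ψ x + (hess ψ x u + (lam + ρ) • u), u⟫_ℝ = 0 := by
    rw [hu.dual hψ, inner_zero_left]
  have h2 := h.psd u
  rw [real_inner_comm] at h2
  simp only [inner_add_left, real_inner_smul_left, real_inner_self_eq_norm_sq] at h1 h2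
  have h3 : -(‖∇ ψ x‖ * ‖u‖) ≤ ⟪∇ ψ x, u⟫_ℝ := (abs_le.mp (abs_real_inner_le_norm _ _)).1
  -- Pair stationarity with `u`: as `H + lam` is positive semidefinite, the extra `ρ` gives `ρ‖u‖ ≤
  -- ‖g‖`. With `ρ² = σ‖g‖` this becomes `σ‖u‖ ≤ ρ`.
  have h4 : ρ * ‖u‖ ^ 2 ≤ ‖∇ ψ x‖ * ‖u‖ := by linarith
  have hl := h.lam_nonneg
  rcases eq_or_lt_of_le (norm_nonneg u) with h0 | h0
  · rw [← h0]; linarith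
  · have h5 : ρ * ‖u‖ ≤ ‖∇ ψ x‖ := by
      refine le_of_mul_le_mul_right ?_ h0
      linarith
    have h6 : ρ * (σ * ‖u‖) ≤ ρ * ρ := by nlinarith
    have := le_of_mul_le_mul_left h6 hρpos
    linarith

end Subproblem
/-! ### Lipschitz continuity along a segment -/

section LipschitzSegment

open Set Filter

variable {E G : Type*} [NormedAddCommGroup E] [NormedSpace ℝ E] [NormedAddCommGroup G]
  {L : ℝ≥0} {F : E → G} {S : Set E} {x y : E}

omit [NormedSpace ℝ E] in
theorem LipschitzAlong.continuousAt (h : LipschitzAlong L F S) (hx : x ∈ S) :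
    ContinuousAt F x := by
  rw [ContinuousAt, tendsto_iff_norm_sub_tendsto_zero]
  have h1 : Tendsto (fun y => (L : ℝ) * ‖y - x‖) (𝓝 x) (𝓝 0) := by
    have : Continuous fun y => (L : ℝ) * ‖y - x‖ := by fun_prop
    simpa using this.tendsto x
  exact squeeze_zero' (Eventually.of_forall fun _ => norm_nonneg _) (h x hx) h1

/-- The local condition bounds the right slopes along the segment by `L‖y - x‖`, and a mean value
inequality for slopes integrates this without differentiability. It requires strict inequality,
hence the slack `r`, which is removed at the end. -/
theorem LipschitzAlong.norm_sub_le (h : LipschitzAlong L F S) (hS : Convex ℝ S)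
    (hx : x ∈ S) (hy : y ∈ S) : ‖F y - F x‖ ≤ L * ‖y - x‖ := by
  set γ : ℝ → E := fun t => x + t • (y - x) with hγ
  have hγS : ∀ t ∈ Icc (0 : ℝ) 1, γ t ∈ S := fun t ht =>
    hS.add_smul_sub_mem hx hy ht
  have hγc : Continuous γ := by fun_prop
  have hγsub : ∀ a b, ‖γ a - γ b‖ = |a - b| * ‖y - x‖ := fun a b => by
    rw [← Real.norm_eq_abs, ← norm_smul, hγ]
    congr 1
    module
  set w : ℝ → G := fun t => F (γ t) - F x with hw
  have hwc : ContinuousOn w (Icc 0 1) := fun t ht =>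
    (((h.continuousAt (hγS t ht)).comp hγc.continuousAt).sub continuousAt_const).continuousWithinAt
  have hslope : ∀ t ∈ Ico (0 : ℝ) 1, ∀ r, L * ‖y - x‖ < r →
      ∃ᶠ z in 𝓝[>] t, slope (norm ∘ w) t z < r := by
    intro t ht r hr
    have h1 : ∀ᶠ z in 𝓝[>] t, ‖F (γ z) - F (γ t)‖ ≤ L * ‖γ z - γ t‖ :=
      (hγc.continuousAt.tendsto.eventually (h _ (hγS t ⟨ht.1, ht.2.le⟩))).filter_mono
        nhdsWithin_le_nhds
    refine Eventually.frequently ?_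
    filter_upwards [h1, self_mem_nhdsWithin] with z hz hzt
    have hzt' : 0 < z - t := sub_pos.mpr hzt
    refine lt_of_le_of_lt ?_ hr
    rw [slope_def_field, div_le_iff₀ hzt']
    have h2 : ‖w z‖ - ‖w t‖ ≤ ‖F (γ z) - F (γ t)‖ := by
      refine (norm_sub_norm_le _ _).trans (le_of_eq ?_)
      simp [hw]
    rw [hγsub, abs_of_pos hzt'] at hz
    calc _ ≤ _ := h2
      _ ≤ _ := hz
      _ = _ := by ring
  have key : ∀ r : ℝ, 0 < r → ‖w 1‖ ≤ L * ‖y - x‖ + r := by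
    intro r hr
    have := image_norm_le_of_liminf_right_slope_norm_lt_deriv_boundary
      (f := w) (f' := fun _ => L * ‖y - x‖) (B := fun t => (L * ‖y - x‖ + r) * t)
      (B' := fun _ => L * ‖y - x‖ + r) hwc hslope (by simp [hw, hγ]) (by fun_prop)
      (fun t _ => by simpa using ((hasDerivAt_id t).const_mul (L * ‖y - x‖ + r)).hasDerivWithinAt)
      (fun t _ _ => by linarith) (right_mem_Icc.mpr zero_le_one)
    simpa using this
  have h1 : ‖w 1‖ ≤ L * ‖y - x‖ := le_of_forall_pos_le_add key
  simpa [hw, hγ] using h1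

/-- Perturbations in all directions are what bounds the full derivative; Lipschitz continuity on the
segment alone would control only its direction. -/
theorem LipschitzAlong.norm_fderiv_le [NormedSpace ℝ G] (h : LipschitzAlong L F S) (hx : x ∈ S) :
    ‖fderiv ℝ F x‖ ≤ L :=
  norm_fderiv_le_of_lip' ℝ L.coe_nonneg (h x hx)

end LipschitzSegment

/-! ### Half the squared norm -/

section HalfNormSq

variable {E G : Type*} [NormedAddCommGroup E] [NormedSpace ℝ E]
  [NormedAddCommGroup G] [InnerProductSpace ℝ G] {L : ℝ≥0} {F : E → G} {S : Set E} {x y : E}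

theorem fderiv_half_norm_sq_apply (hF : ContDiff ℝ 2 F) (x v : E) :
    fderiv ℝ (fun z => (1 / 2 : ℝ) * ‖F z‖ ^ 2) x v = ⟪F x, fderiv ℝ F x v⟫_ℝ := by
  have h := ((hF.differentiable (by norm_num) x).hasFDerivAt.norm_sq).const_mul (1 / 2 : ℝ)
  rw [h.fderiv]
  simp

theorem fderiv_fderiv_half_norm_sq_apply (hF : ContDiff ℝ 2 F) (x u v : E) :
    fderiv ℝ (fderiv ℝ fun z => (1 / 2 : ℝ) * ‖F z‖ ^ 2) x u v =
      ⟪fderiv ℝ F x u, fderiv ℝ F x v⟫_ℝ + ⟪F x, fderiv ℝ (fderiv ℝ F) x u v⟫_ℝ := by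
  have hq : ContDiff ℝ 2 fun z => (1 / 2 : ℝ) * ‖F z‖ ^ 2 := contDiff_const.mul (hF.norm_sq ℝ)
  have h1 : HasFDerivAt (fun z => fderiv ℝ (fun z => (1 / 2 : ℝ) * ‖F z‖ ^ 2) z v) _ x :=
    (hq.differentiable_fderiv_two x).hasFDerivAt.clm_apply (hasFDerivAt_const v x)
  have h2 : (fun z => fderiv ℝ (fun z => (1 / 2 : ℝ) * ‖F z‖ ^ 2) z v) =
      fun z => ⟪F z, fderiv ℝ F z v⟫_ℝ := by
    ext z; exact fderiv_half_norm_sq_apply hF z v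
  have h3 : HasFDerivAt (fun z => fderiv ℝ F z v) _ x :=
    (hF.differentiable_fderiv_two x).hasFDerivAt.clm_apply (hasFDerivAt_const v x)
  have h4 := fderiv_inner_apply ℝ (hF.differentiable (by norm_num) x) h3.differentiableAt u
  rw [← h2, h1.fderiv, h3.fderiv] at h4
  simp only [ContinuousLinearMap.comp_zero, zero_add, ContinuousLinearMap.flip_apply] at h4
  rw [h4, add_comm]

theorem norm_fderiv_half_norm_sq_le (hF : ContDiff ℝ 2 F) (h : LipschitzAlongC2 L F S)
    (hx : x ∈ S) (hFx : ‖F x‖ ≤ 1) :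
    ‖fderiv ℝ (fun z => (1 / 2 : ℝ) * ‖F z‖ ^ 2) x‖ ≤ L := by
  refine ContinuousLinearMap.opNorm_le_bound _ L.coe_nonneg fun v => ?_
  rw [fderiv_half_norm_sq_apply hF]
  refine (norm_inner_le_norm _ _).trans ?_
  have := (fderiv ℝ F x).le_of_opNorm_le (h.1.norm_fderiv_le hx) v
  calc ‖F x‖ * ‖fderiv ℝ F x v‖ ≤ 1 * (L * ‖v‖) := by gcongr
    _ = _ := one_mul _

theorem ContinuousLinearMap.le_of_opNorm_le₂ {G' : Type*} [NormedAddCommGroup G']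
    [NormedSpace ℝ G'] {T : E →L[ℝ] E →L[ℝ] G'} {C : ℝ} (hT : ‖T‖ ≤ C) (u v : E) :
    ‖T u v‖ ≤ C * ‖u‖ * ‖v‖ :=
  (T u).le_of_opNorm_le (T.le_of_opNorm_le hT u) v

theorem norm_fderiv_fderiv_half_norm_sq_le (hF : ContDiff ℝ 2 F) (h : LipschitzAlongC2 L F S)
    (hx : x ∈ S) (hFx : ‖F x‖ ≤ 1) :
    ‖fderiv ℝ (fderiv ℝ fun z => (1 / 2 : ℝ) * ‖F z‖ ^ 2) x‖ ≤ (L : ℝ) ^ 2 + L := by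
  refine ContinuousLinearMap.opNorm_le_bound₂ _ (by positivity) fun u v => ?_
  rw [fderiv_fderiv_half_norm_sq_apply hF]
  have h1 := fun w => (fderiv ℝ F x).le_of_opNorm_le (h.1.norm_fderiv_le hx) w
  have h2 := ContinuousLinearMap.le_of_opNorm_le₂ (h.2.1.norm_fderiv_le hx) u v
  calc _ ≤ ‖fderiv ℝ F x u‖ * ‖fderiv ℝ F x v‖ + ‖F x‖ * ‖fderiv ℝ (fderiv ℝ F) x u v‖ :=
        (norm_add_le _ _).trans (add_le_add (norm_inner_le_norm _ _) (norm_inner_le_norm _ _))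
    _ ≤ (L * ‖u‖) * (L * ‖v‖) + 1 * (L * ‖u‖ * ‖v‖) := by gcongr <;> simp_all
    _ = _ := by ring

theorem norm_fderiv_fderiv_half_norm_sq_sub_le (hF : ContDiff ℝ 2 F) (h : LipschitzAlongC2 L F S)
    (hS : Convex ℝ S) (hx : x ∈ S) (hy : y ∈ S) (hFx : ‖F x‖ ≤ 1) :
    ‖fderiv ℝ (fderiv ℝ fun z => (1 / 2 : ℝ) * ‖F z‖ ^ 2) y -
      fderiv ℝ (fderiv ℝ fun z => (1 / 2 : ℝ) * ‖F z‖ ^ 2) x‖ ≤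
      (3 * (L : ℝ) ^ 2 + L) * ‖y - x‖ := by
  refine ContinuousLinearMap.opNorm_le_bound₂ _ (by positivity) fun u v => ?_
  rw [sub_apply, sub_apply,
    fderiv_fderiv_half_norm_sq_apply hF, fderiv_fderiv_half_norm_sq_apply hF]
  set A := fderiv ℝ F with hA
  set D := fderiv ℝ A with hD
  have hx1 : ‖A x u‖ ≤ L * ‖u‖ := (A x).le_of_opNorm_le (h.1.norm_fderiv_le hx) u
  have hy1 : ‖A y v‖ ≤ L * ‖v‖ := (A y).le_of_opNorm_le (h.1.norm_fderiv_le hy) v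
  have hd1 : ∀ w, ‖(A y - A x) w‖ ≤ L * ‖y - x‖ * ‖w‖ := fun w =>
    (A y - A x).le_of_opNorm_le (h.2.1.norm_sub_le hS hx hy) w
  have hy2 : ‖D y u v‖ ≤ L * ‖u‖ * ‖v‖ :=
    ContinuousLinearMap.le_of_opNorm_le₂ (h.2.1.norm_fderiv_le hy) u v
  have hd2 : ‖(D y - D x) u v‖ ≤ L * ‖y - x‖ * ‖u‖ * ‖v‖ :=
    ContinuousLinearMap.le_of_opNorm_le₂ (h.2.2.norm_sub_le hS hx hy) u v
  have hd0 : ‖F y - F x‖ ≤ L * ‖y - x‖ := h.1.norm_sub_le hS hx hy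
  -- The telescoping leaves `F` undifferenced only at the base point `x`, so `‖F x‖ ≤ 1` suffices
  -- and no residual bound at `y` is needed.
  have e : ⟪A y u, A y v⟫_ℝ + ⟪F y, D y u v⟫_ℝ - (⟪A x u, A x v⟫_ℝ + ⟪F x, D x u v⟫_ℝ) =
      ⟪(A y - A x) u, A y v⟫_ℝ + ⟪A x u, (A y - A x) v⟫_ℝ + ⟪F y - F x, D y u v⟫_ℝ
        + ⟪F x, (D y - D x) u v⟫_ℝ := by
    simp only [sub_apply, inner_sub_left, inner_sub_right]
    ring
  rw [e]
  calc _ ≤ ‖(A y - A x) u‖ * ‖A y v‖ + ‖A x u‖ * ‖(A y - A x) v‖ + ‖F y - F x‖ * ‖D y u v‖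
        + ‖F x‖ * ‖(D y - D x) u v‖ :=
      norm_add₄_le.trans (by gcongr <;> exact norm_inner_le_norm _ _)
    _ ≤ (L * ‖y - x‖ * ‖u‖) * (L * ‖v‖) + (L * ‖u‖) * (L * ‖y - x‖ * ‖v‖)
        + (L * ‖y - x‖) * (L * ‖u‖ * ‖v‖) + 1 * (L * ‖y - x‖ * ‖u‖ * ‖v‖) := by
      have := hd1 u
      have := hd1 v
      gcongr
    _ = _ := by ring

end HalfNormSq

/-! ### Derivatives of the residual objective -/

section Residual

variable {N M : ℕ} {f : EuclideanSpace ℝ (Fin N) → ℝ}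
  {c : EuclideanSpace ℝ (Fin N) → EuclideanSpace ℝ (Fin M)}
  {x y s : EuclideanSpace ℝ (Fin N)} {t : ℝ} {L : ℝ≥0} {S : Set (EuclideanSpace ℝ (Fin N))}

theorem norm_sq_resid (f : EuclideanSpace ℝ (Fin N) → ℝ)
    (c : EuclideanSpace ℝ (Fin N) → EuclideanSpace ℝ (Fin M)) (x : EuclideanSpace ℝ (Fin N))
    (t : ℝ) : ‖resid f c x t‖ ^ 2 = ‖c x‖ ^ 2 + (f x - t) ^ 2 := by
  rw [resid, WithLp.prod_norm_sq_eq_of_L2]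
  simp

theorem norm_le_norm_resid (f : EuclideanSpace ℝ (Fin N) → ℝ)
    (c : EuclideanSpace ℝ (Fin N) → EuclideanSpace ℝ (Fin M)) (x : EuclideanSpace ℝ (Fin N))
    (t : ℝ) : ‖c x‖ ≤ ‖resid f c x t‖ :=
  le_of_sq_le_sq (by rw [norm_sq_resid]; nlinarith [sq_nonneg (f x - t)]) (norm_nonneg _)

theorem abs_sub_le_norm_resid (f : EuclideanSpace ℝ (Fin N) → ℝ)
    (c : EuclideanSpace ℝ (Fin N) → EuclideanSpace ℝ (Fin M)) (x : EuclideanSpace ℝ (Fin N))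
    (t : ℝ) : |f x - t| ≤ ‖resid f c x t‖ :=
  abs_le_of_sq_le_sq (by rw [norm_sq_resid]; nlinarith [sq_nonneg ‖c x‖]) (norm_nonneg _)

theorem residObj_eq (f : EuclideanSpace ℝ (Fin N) → ℝ)
    (c : EuclideanSpace ℝ (Fin N) → EuclideanSpace ℝ (Fin M)) (t : ℝ) :
    residObj f c t = (fun z => (1 / 2 : ℝ) * ‖c z‖ ^ 2) +
      fun z => (1 / 2 : ℝ) * ‖f z - t‖ ^ 2 := by
  ext z
  simp only [residObj, norm_sq_resid, Pi.add_apply, Real.norm_eq_abs, sq_abs]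
  ring

theorem contDiff_half_norm_sq {G : Type*} [NormedAddCommGroup G] [InnerProductSpace ℝ G]
    {F : EuclideanSpace ℝ (Fin N) → G} (hF : ContDiff ℝ 2 F) :
    ContDiff ℝ 2 fun z => (1 / 2 : ℝ) * ‖F z‖ ^ 2 :=
  contDiff_const.mul (hF.norm_sq ℝ)

theorem contDiff_residObj (hf : ContDiff ℝ 2 f) (hc : ContDiff ℝ 2 c) (t : ℝ) :
    ContDiff ℝ 2 (residObj f c t) := by
  rw [residObj_eq]
  exact (contDiff_half_norm_sq hc).add (contDiff_half_norm_sq (hf.sub contDiff_const))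

theorem fderiv_residObj (hf : ContDiff ℝ 2 f) (hc : ContDiff ℝ 2 c) (t : ℝ) :
    fderiv ℝ (residObj f c t) = (fun x => fderiv ℝ (fun z => (1 / 2 : ℝ) * ‖c z‖ ^ 2) x) +
      fun x => fderiv ℝ (fun z => (1 / 2 : ℝ) * ‖f z - t‖ ^ 2) x := by
  ext1 x
  rw [residObj_eq]
  exact fderiv_add ((contDiff_half_norm_sq hc).differentiable (by norm_num) x)
    ((contDiff_half_norm_sq (hf.sub contDiff_const)).differentiable (by norm_num) x)

theorem fderiv_fderiv_residObj (hf : ContDiff ℝ 2 f) (hc : ContDiff ℝ 2 c) (t : ℝ)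
    (x : EuclideanSpace ℝ (Fin N)) :
    fderiv ℝ (fderiv ℝ (residObj f c t)) x =
      fderiv ℝ (fderiv ℝ (fun z => (1 / 2 : ℝ) * ‖c z‖ ^ 2)) x +
      fderiv ℝ (fderiv ℝ (fun z => (1 / 2 : ℝ) * ‖f z - t‖ ^ 2)) x := by
  rw [fderiv_residObj hf hc]
  exact fderiv_add ((contDiff_half_norm_sq hc).differentiable_fderiv_two x)
    ((contDiff_half_norm_sq (hf.sub contDiff_const)).differentiable_fderiv_two x)

theorem LipschitzAlongC2.sub_const {E G : Type*} [NormedAddCommGroup E] [NormedSpace ℝ E]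
    [NormedAddCommGroup G] [NormedSpace ℝ G] {L : ℝ≥0} {F : E → G} {S : Set E}
    (h : LipschitzAlongC2 L F S) (b : G) : LipschitzAlongC2 L (fun z => F z - b) S := by
  have e : fderiv ℝ (fun z => F z - b) = fderiv ℝ F := by
    ext1 z
    exact fderiv_sub_const b
  rw [LipschitzAlongC2, e]
  refine ⟨fun x hx => ?_, h.2⟩
  simpa using h.1 x hx

theorem norm_gradient_residObj_le (hf : ContDiff ℝ 2 f) (hc : ContDiff ℝ 2 c)
    (hfL : LipschitzAlongC2 L f S) (hcL : LipschitzAlongC2 L c S) (hx : x ∈ S)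
    (hr : ‖resid f c x t‖ ≤ 1) : ‖∇ (residObj f c t) x‖ ≤ 2 * L := by
  rw [norm_gradient, fderiv_residObj hf hc, Pi.add_apply]
  have h1 := norm_fderiv_half_norm_sq_le hc hcL hx ((norm_le_norm_resid f c x t).trans hr)
  have h2 := norm_fderiv_half_norm_sq_le (hf.sub contDiff_const) (hfL.sub_const t) hx
    ((abs_sub_le_norm_resid f c x t).trans hr)
  refine le_trans (ContinuousLinearMap.opNorm_add_le _ _) ?_
  linarith

theorem norm_fderiv_fderiv_residObj_le (hf : ContDiff ℝ 2 f) (hc : ContDiff ℝ 2 c)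
    (hfL : LipschitzAlongC2 L f S) (hcL : LipschitzAlongC2 L c S) (hx : x ∈ S)
    (hr : ‖resid f c x t‖ ≤ 1) :
    ‖fderiv ℝ (fderiv ℝ (residObj f c t)) x‖ ≤ 2 * ((L : ℝ) ^ 2 + L) := by
  rw [fderiv_fderiv_residObj hf hc]
  have h1 := norm_fderiv_fderiv_half_norm_sq_le hc hcL hx ((norm_le_norm_resid f c x t).trans hr)
  have h2 := norm_fderiv_fderiv_half_norm_sq_le (hf.sub contDiff_const) (hfL.sub_const t) hx
    ((abs_sub_le_norm_resid f c x t).trans hr)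
  refine le_trans (ContinuousLinearMap.opNorm_add_le _ _) ?_
  linarith

theorem norm_fderiv_fderiv_residObj_sub_le (hf : ContDiff ℝ 2 f) (hc : ContDiff ℝ 2 c)
    (hfL : LipschitzAlongC2 L f S) (hcL : LipschitzAlongC2 L c S) (hS : Convex ℝ S)
    (hx : x ∈ S) (hy : y ∈ S) (hr : ‖resid f c x t‖ ≤ 1) :
    ‖fderiv ℝ (fderiv ℝ (residObj f c t)) y - fderiv ℝ (fderiv ℝ (residObj f c t)) x‖ ≤
      2 * (3 * (L : ℝ) ^ 2 + L) * ‖y - x‖ := by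
  rw [fderiv_fderiv_residObj hf hc, fderiv_fderiv_residObj hf hc]
  have h1 := norm_fderiv_fderiv_half_norm_sq_sub_le hc hcL hS hx hy
    ((norm_le_norm_resid f c x t).trans hr)
  have h2 := norm_fderiv_fderiv_half_norm_sq_sub_le (hf.sub contDiff_const) (hfL.sub_const t) hS
    hx hy ((abs_sub_le_norm_resid f c x t).trans hr)
  rw [add_sub_add_comm]
  refine le_trans (ContinuousLinearMap.opNorm_add_le _ _) ?_
  linarith

end Residual

/-! ### Taylor estimates -/

section Taylor

variable {N : ℕ} {ψ : EuclideanSpace ℝ (Fin N) → ℝ} {x y s : EuclideanSpace ℝ (Fin N)} {K : ℝ}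

theorem norm_fderiv_sub_taylor_le (hψ : ContDiff ℝ 2 ψ) (hK : 0 ≤ K)
    (h : ∀ y ∈ segment ℝ x (x + s),
      ‖fderiv ℝ (fderiv ℝ ψ) y - fderiv ℝ (fderiv ℝ ψ) x‖ ≤ K * ‖y - x‖)
    (hy : y ∈ segment ℝ x (x + s)) :
    ‖fderiv ℝ ψ y - fderiv ℝ ψ x - fderiv ℝ (fderiv ℝ ψ) x (y - x)‖ ≤ K * ‖s‖ ^ 2 := by
  have hle : ∀ z ∈ segment ℝ x (x + s), ‖z - x‖ ≤ ‖s‖ := fun z hz => by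
    simpa using norm_sub_le_of_mem_segment hz
  have h1 := (convex_segment x (x + s)).norm_image_sub_le_of_norm_fderiv_le' (𝕜 := ℝ)
    (f := fderiv ℝ ψ) (C := K * ‖s‖) (φ := fderiv ℝ (fderiv ℝ ψ) x)
    (fun z _ => hψ.differentiable_fderiv_two z)
    (fun z hz => (h z hz).trans (mul_le_mul_of_nonneg_left (hle z hz) hK))
    (left_mem_segment ℝ _ _) hy
  calc _ ≤ _ := h1
    _ ≤ K * ‖s‖ * ‖s‖ := mul_le_mul_of_nonneg_left (hle y hy) (by positivity)
    _ = _ := by ring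

theorem norm_gradient_add_sub_le (hψ : ContDiff ℝ 2 ψ) (hK : 0 ≤ K)
    (h : ∀ y ∈ segment ℝ x (x + s),
      ‖fderiv ℝ (fderiv ℝ ψ) y - fderiv ℝ (fderiv ℝ ψ) x‖ ≤ K * ‖y - x‖) :
    ‖∇ ψ (x + s) - (∇ ψ x + hess ψ x s)‖ ≤ K * ‖s‖ ^ 2 := by
  have h1 := norm_fderiv_sub_taylor_le hψ hK h (right_mem_segment ℝ _ _)
  rwa [add_sub_cancel_left, ← (rieszInv N).norm_map, map_sub, map_sub, ← hess_apply hψ,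
    ← gradient_eq_rieszInv, ← gradient_eq_rieszInv, sub_sub] at h1

/-- Integrates the first-order estimate along the segment. The constant `K` in place of `K / 6` is
crude but harmless. -/
theorem abs_sub_quadModel_le (hψ : ContDiff ℝ 2 ψ) (hK : 0 ≤ K)
    (h : ∀ y ∈ segment ℝ x (x + s),
      ‖fderiv ℝ (fderiv ℝ ψ) y - fderiv ℝ (fderiv ℝ ψ) x‖ ≤ K * ‖y - x‖) :
    |ψ (x + s) - quadModel ψ x s| ≤ K * ‖s‖ ^ 3 := by
  set D := fderiv ℝ (fderiv ℝ ψ) x with hD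
  set w : ℝ → ℝ := fun τ => ψ (x + τ • s) - τ * fderiv ℝ ψ x s - τ ^ 2 / 2 * D s s with hw
  have hderiv : ∀ τ ∈ Set.Icc (0 : ℝ) 1, HasDerivWithinAt w
      (fderiv ℝ ψ (x + τ • s) s - fderiv ℝ ψ x s - τ * D s s) (Set.Icc 0 1) τ := by
    intro τ _
    have e1 : HasDerivAt (fun τ : ℝ => x + τ • s) s τ := by
      simpa using ((hasDerivAt_id τ).smul_const s).const_add x
    have e2 := (hψ.differentiable (by norm_num) (x + τ • s)).hasFDerivAt.comp_hasDerivAt τ e1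
    have e3 := ((e2.sub ((hasDerivAt_id τ).mul_const (fderiv ℝ ψ x s))).sub
      ((((hasDerivAt_id τ).pow 2).div_const 2).mul_const (D s s))).hasDerivWithinAt
      (s := Set.Icc (0 : ℝ) 1)
    refine e3.congr_deriv ?_
    simp
  have hb : ∀ τ ∈ Set.Ico (0 : ℝ) 1,
      ‖fderiv ℝ ψ (x + τ • s) s - fderiv ℝ ψ x s - τ * D s s‖ ≤ K * ‖s‖ ^ 3 := by
    intro τ hτ
    have hmem : x + τ • s ∈ segment ℝ x (x + s) := by
      rw [segment_eq_image']
      exact ⟨τ, ⟨hτ.1, hτ.2.le⟩, by simp⟩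
    have h1 := norm_fderiv_sub_taylor_le hψ hK h hmem
    have h2 := ContinuousLinearMap.le_of_opNorm_le _ h1 s
    have e : fderiv ℝ ψ (x + τ • s) s - fderiv ℝ ψ x s - τ * D s s =
      (fderiv ℝ ψ (x + τ • s) - fderiv ℝ ψ x - D (x + τ • s - x)) s := by
      simp
    rw [e]
    calc _ ≤ _ := h2
      _ = _ := by ring
  have h1 := norm_image_sub_le_of_norm_deriv_le_segment_01' hderiv hb
  have e : w 1 - w 0 = ψ (x + s) - quadModel ψ x s := by
    rw [quadModel, inner_gradient, real_inner_comm, inner_hess hψ]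
    simp only [hw, one_smul, zero_smul, add_zero]
    ring
  rwa [e, Real.norm_eq_abs] at h1

end Taylor
/-! ### The effect of CONTRACT -/

section ContractStep

/-- The factor by which consecutive contractions increase the ratio of multiplier to step
length. -/
def TraceParams.growth (P : TraceParams) : ℝ := min P.γlam P.γC⁻¹

theorem TraceParams.one_lt_growth (P : TraceParams) : 1 < P.growth :=
  lt_min P.one_lt_γlam ((one_lt_inv₀ P.γC_pos).mpr P.γC_lt_one)

variable {N : ℕ} {P : TraceParams} {ψ : EuclideanSpace ℝ (Fin N) → ℝ}
  {x s s' : EuclideanSpace ℝ (Fin N)} {δ δ' lam lam' : ℝ}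

/-- Either branch returns the norm of a regularized solution, whose parameter must then be the new
multiplier. The lower ratio bound comes from `IsRegSolution.mul_norm_le` in the first branch and
from the choice of `μ` in the second. -/
theorem Contract.of_lt (hψ : ContDiff ℝ 2 ψ) (hg : ∇ ψ x ≠ 0) (h : IsTRSolution ψ x δ s lam)
    (h' : IsTRSolution ψ x δ' s' lam') (hc : Contract P ψ x s lam δ')
    (hlt : lam < P.σlo * ‖s‖) :
    δ' ≤ ‖s‖ ∧ P.σlo * ‖s'‖ ≤ lam' ∧ lam' ≤ P.σhi * ‖s'‖ := by
  have hl := h.lam_nonneg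
  have hs' : 0 < ‖s'‖ := norm_pos_iff.mpr (h'.ne_zero hg)
  have main : ∀ u μ, lam < μ → IsRegSolution ψ x μ u → δ' = ‖u‖ →
      (P.σlo * ‖u‖ ≤ μ) → (μ / ‖u‖ ≤ P.σhi) →
      δ' ≤ ‖s‖ ∧ P.σlo * ‖s'‖ ≤ lam' ∧ lam' ≤ P.σhi * ‖s'‖ := by
    intro u μ hμ hu hδ h1 h2
    subst hδ
    obtain ⟨e1, e2⟩ := h'.eq_of_isRegSolution hψ hg hu (hl.trans_lt hμ)
    rw [e1] at hs'
    rw [e1, e2]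
    exact ⟨hu.norm_le_of_lt (h.isRegSolution hψ) hμ, h1, (div_le_iff₀ hs').mp h2⟩
  have hroot : lam < lam + Real.sqrt (P.σlo * ‖∇ ψ x‖) :=
    lt_add_of_pos_right _ (Real.sqrt_pos.mpr (mul_pos P.σlo_pos (norm_pos_iff.mpr hg)))
  rcases hc with ⟨-, _, rfl, sHat, hHat, ⟨h1, h2⟩ | ⟨-, μ, hμ, -, u, hu, h1, h2, h3⟩⟩ | ⟨h1, -⟩
  · exact main sHat _ hroot hHat h2 (hHat.mul_norm_le hψ h P.σlo_pos hg) h1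
  · refine main u μ hμ hu h3 ?_ h2
    rw [h3] at h'
    have hu0 : 0 < ‖u‖ := hs'.trans_le h'.norm_le
    exact (le_div_iff₀ hu0).mp h1
  · linarith

/-- Either the multiplier grows by exactly `γlam` while the step does not lengthen, or the step
shrinks by exactly `γC` while the multiplier does not drop. So the ratio grows at least by the
smaller factor, and at most by `γlam / γC`. -/
theorem Contract.of_le (hψ : ContDiff ℝ 2 ψ) (hg : ∇ ψ x ≠ 0) (h : IsTRSolution ψ x δ s lam)
    (h' : IsTRSolution ψ x δ' s' lam') (hc : Contract P ψ x s lam δ')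
    (hle : P.σlo * ‖s‖ ≤ lam) :
    δ' ≤ ‖s‖ ∧ P.growth * (lam / ‖s‖) * ‖s'‖ ≤ lam' ∧
      lam' ≤ P.γlam / P.γC * (lam / ‖s‖) * ‖s'‖ := by
  have hs : 0 < ‖s‖ := norm_pos_iff.mpr (h.ne_zero hg)
  have hl : 0 < lam := (mul_pos P.σlo_pos hs).trans_le hle
  have hr : 0 < lam / ‖s‖ := div_pos hl hs
  have hrs : lam / ‖s‖ * ‖s‖ = lam := div_mul_cancel₀ _ hs.ne'
  have hγC := P.γC_pos
  have hγlam : 0 < P.γlam := one_pos.trans P.one_lt_γlam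
  have hgrow : 0 < P.growth := one_pos.trans P.one_lt_growth
  rcases hc with ⟨h1, -⟩ | ⟨-, u, hu, h2⟩
  · linarith
  have hlt : lam < P.γlam * lam := lt_mul_of_one_lt_left hl P.one_lt_γlam
  have hus : ‖u‖ ≤ ‖s‖ := hu.norm_le_of_lt (h.isRegSolution hψ) hlt
  split_ifs at h2 with h3
  · subst h2
    obtain ⟨e1, e2⟩ := h'.eq_of_isRegSolution hψ hg hu (hl.trans hlt)
    rw [e1, e2]
    refine ⟨hus, ?_, ?_⟩
    · calc P.growth * (lam / ‖s‖) * ‖u‖ ≤ P.γlam * (lam / ‖s‖) * ‖s‖ := by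
            gcongr
            exact min_le_left _ _
        _ = P.γlam * lam := by rw [mul_assoc, hrs]
    · calc P.γlam * lam = P.γlam / P.γC * (lam / ‖s‖) * (P.γC * ‖s‖) := by
            field_simp
        _ ≤ _ := by gcongr
  · subst h2
    have hlts : P.γC * ‖s‖ < ‖s‖ := mul_lt_of_lt_one_left hs P.γC_lt_one
    have h4 : lam ≤ lam' := (h'.isRegSolution hψ).le_of_norm_lt (h.isRegSolution hψ)
      (h'.norm_le.trans_lt hlts)
    have e1 : ‖s'‖ = P.γC * ‖s‖ := h'.norm_eq (hl.trans_le h4)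
    have h5 : lam' ≤ P.γlam * lam := hu.le_of_norm_lt (h'.isRegSolution hψ)
      (by rw [e1]; exact not_le.mp h3)
    rw [e1]
    refine ⟨hlts.le, ?_, ?_⟩
    · calc P.growth * (lam / ‖s‖) * (P.γC * ‖s‖) ≤ P.γC⁻¹ * (lam / ‖s‖) * (P.γC * ‖s‖) := by
            gcongr
            exact min_le_right _ _
        _ = lam := by field_simp
        _ ≤ lam' := h4
    · calc lam' ≤ P.γlam * lam := h5
        _ = P.γlam / P.γC * (lam / ‖s‖) * (P.γC * ‖s‖) := by field_simp

theorem Contract.radius_le (hψ : ContDiff ℝ 2 ψ) (hg : ∇ ψ x ≠ 0)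
    (h : IsTRSolution ψ x δ s lam) (h' : IsTRSolution ψ x δ' s' lam')
    (hc : Contract P ψ x s lam δ') : δ' ≤ ‖s‖ := by
  rcases lt_or_ge lam (P.σlo * ‖s‖) with h0 | h0
  · exact (hc.of_lt hψ hg h h' h0).1
  · exact (hc.of_le hψ hg h h' h0).1

theorem Contract.growth_le (hψ : ContDiff ℝ 2 ψ) (hg : ∇ ψ x ≠ 0)
    (h : IsTRSolution ψ x δ s lam) (h' : IsTRSolution ψ x δ' s' lam')
    (hc : Contract P ψ x s lam δ') {r : ℝ} (hr : P.σlo ≤ r) (hle : r * ‖s‖ ≤ lam) :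
    P.growth * r * ‖s'‖ ≤ lam' := by
  have hs : 0 < ‖s‖ := norm_pos_iff.mpr (h.ne_zero hg)
  have h0 : P.σlo * ‖s‖ ≤ lam := (mul_le_mul_of_nonneg_right hr hs.le).trans hle
  refine le_trans ?_ (hc.of_le hψ hg h h' h0).2.1
  have := P.one_lt_growth
  have : r ≤ lam / ‖s‖ := (le_div_iff₀ hs).mpr hle
  gcongr

theorem Contract.σlo_mul_le (hψ : ContDiff ℝ 2 ψ) (hg : ∇ ψ x ≠ 0)
    (h : IsTRSolution ψ x δ s lam) (h' : IsTRSolution ψ x δ' s' lam')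
    (hc : Contract P ψ x s lam δ') : P.σlo * ‖s'‖ ≤ lam' := by
  rcases lt_or_ge lam (P.σlo * ‖s‖) with h0 | h0
  · exact (hc.of_lt hψ hg h h' h0).2.1
  · refine le_trans ?_ (hc.growth_le hψ hg h h' le_rfl h0)
    have := P.one_lt_growth
    have := P.σlo_pos
    gcongr
    exact le_mul_of_one_le_left (by linarith) (by linarith)

theorem Contract.le_max_mul (hψ : ContDiff ℝ 2 ψ) (hg : ∇ ψ x ≠ 0)
    (h : IsTRSolution ψ x δ s lam) (h' : IsTRSolution ψ x δ' s' lam')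
    (hc : Contract P ψ x s lam δ') {κ : ℝ} (hκ : lam ≤ κ * ‖s‖) :
    lam' / ‖s'‖ ≤ max P.σhi (P.γlam / P.γC * κ) := by
  have hs : 0 < ‖s‖ := norm_pos_iff.mpr (h.ne_zero hg)
  have hs' : 0 < ‖s'‖ := norm_pos_iff.mpr (h'.ne_zero hg)
  rw [div_le_iff₀ hs']
  rcases lt_or_ge lam (P.σlo * ‖s‖) with h0 | h0
  · exact (hc.of_lt hψ hg h h' h0).2.2.trans (by gcongr; exact le_max_left _ _)
  · refine (hc.of_le hψ hg h h' h0).2.2.trans ?_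
    have : lam / ‖s‖ ≤ κ := (div_le_iff₀ hs).mpr hκ
    have := P.γC_pos
    have := P.one_lt_γlam
    gcongr
    exact le_trans (by gcongr) (le_max_right _ _)

end ContractStep

/-! ### One iteration of the phase 2 method -/

section Iteration

/-- A Lipschitz constant for the Hessian of the residual objective from a point with residual
norm at most one. -/
def hessLip (L : ℝ≥0) : ℝ := 2 * (3 * (L : ℝ) ^ 2 + L)

/-- Trial steps whose multiplier is at least `ratioBound P L` times their length are not
contracted. -/
def ratioBound (P : TraceParams) (L : ℝ≥0) : ℝ := 2 * (P.η + hessLip L)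

/-- An upper bound for the ratio bounds `σ` of a run. -/
def sigmaMax (P : TraceParams) (L : ℝ≥0) (Δ₀ σ₀ : ℝ) : ℝ :=
  max σ₀ (max (max P.σhi (P.γlam / P.γC * ratioBound P L))
    (2 * L / Δ₀ ^ 2 + 2 * ((L : ℝ) ^ 2 + L) / Δ₀))

theorem hessLip_nonneg (L : ℝ≥0) : 0 ≤ hessLip L := by
  unfold hessLip
  positivity

/-- The properties shared by all states of a run. -/
structure RunInvariant {N M : ℕ} (P : TraceParams) (f : EuclideanSpace ℝ (Fin N) → ℝ)
    (c : EuclideanSpace ℝ (Fin N) → EuclideanSpace ℝ (Fin M)) (L : ℝ≥0) (εfeas Δ₀ σ₀ : ℝ)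
    (z : PhaseState N) : Prop where
  solves : SolvesSubproblem f c z
  norm_resid : ‖resid f c z.x z.t‖ = εfeas
  target_le : z.t ≤ f z.x
  radius_le : z.δ ≤ z.Δ
  le_Δ : Δ₀ ≤ z.Δ
  σlo_le : P.σlo ≤ z.σ
  σ_le : z.σ ≤ sigmaMax P L Δ₀ σ₀

variable {N M : ℕ} {P : TraceParams} {f : EuclideanSpace ℝ (Fin N) → ℝ}
  {c : EuclideanSpace ℝ (Fin N) → EuclideanSpace ℝ (Fin M)} {L : ℝ≥0}
  {ε εfeas Δ₀ σ₀ : ℝ} {z w : PhaseState N}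

theorem sub_residObj (f : EuclideanSpace ℝ (Fin N) → ℝ)
    (c : EuclideanSpace ℝ (Fin N) → EuclideanSpace ℝ (Fin M)) (z : PhaseState N) :
    residObj f c z.t z.x - residObj f c z.t (z.x + z.s) =
      (‖resid f c z.x z.t‖ ^ 2 - ‖resid f c (z.x + z.s) z.t‖ ^ 2) / 2 := by
  simp only [residObj]
  ring

theorem RunInvariant.norm_pos (h : RunInvariant P f c L εfeas Δ₀ σ₀ z)
    (hz : ¬ AtStationary f c z) : 0 < ‖z.s‖ :=
  norm_pos_iff.mpr (h.solves.ne_zero hz)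

theorem RunInvariant.residual_decrease (h : RunInvariant P f c L εfeas Δ₀ σ₀ z)
    (hz : ¬ AtStationary f c z) (hρ : P.η ≤ stepRatio f c z) :
    2 * P.η * ‖z.s‖ ^ 3 ≤ εfeas ^ 2 - ‖resid f c (z.x + z.s) z.t‖ ^ 2 := by
  have hs := h.norm_pos hz
  rw [stepRatio, decreaseRatio, le_div_iff₀ (by positivity), sub_residObj, h.norm_resid] at hρ
  linarith

/-- An accepted step lowers the target in proportion to the decrease in the residual. -/
theorem RunInvariant.mul_target_decrease (h : RunInvariant P f c L εfeas Δ₀ σ₀ z)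
    (hε : 0 < εfeas) (hD : ‖resid f c (z.x + z.s) z.t‖ ^ 2 ≤ εfeas ^ 2) :
    εfeas ^ 2 - ‖resid f c (z.x + z.s) z.t‖ ^ 2 ≤ 2 * εfeas * (z.t - nextTarget f c z) := by
  rw [nextTarget, h.norm_resid]
  set R := ‖resid f c (z.x + z.s) z.t‖
  set a := f (z.x + z.s) - z.t with ha
  have hR : 0 ≤ R := norm_nonneg _
  have haR : |a| ≤ R := abs_sub_le_norm_resid f c _ _
  have ha2 : a ^ 2 ≤ R ^ 2 := sq_le_sq' (by linarith [(abs_le.mp haR).1]) (abs_le.mp haR).2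
  set q := Real.sqrt (εfeas ^ 2 - R ^ 2 + a ^ 2) with hq
  have hnn : 0 ≤ εfeas ^ 2 - R ^ 2 + a ^ 2 := by nlinarith
  have hq0 : 0 ≤ q := Real.sqrt_nonneg _
  have hq2 : q ^ 2 = εfeas ^ 2 - R ^ 2 + a ^ 2 := Real.sq_sqrt hnn
  have hqε : q ≤ εfeas := le_of_sq_le_sq (by linarith) hε.le
  have haq : |a| ≤ q := abs_le_of_sq_le_sq (by linarith) hq0
  have haq' := abs_le.mp haq
  have e : z.t - (f (z.x + z.s) - q) = q - a := by rw [ha]; ring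
  rw [e]
  -- `q² - a² = εfeas² - R²` factors as `(q - a)(q + a)`, where `q - a ≥ 0` is the target decrease
  -- and `q + a ≤ 2 εfeas`.
  nlinarith [mul_nonneg (sub_nonneg.mpr haq'.2) (show 0 ≤ 2 * εfeas - (q + a) by linarith)]

theorem RunInvariant.taylor_hyp (h : RunInvariant P f c L εfeas Δ₀ σ₀ z)
    (hf : ContDiff ℝ 2 f) (hc : ContDiff ℝ 2 c) (hε : εfeas ≤ 1)
    (hfL : LipschitzAlongC2 L f (segment ℝ z.x (z.x + z.s)))
    (hcL : LipschitzAlongC2 L c (segment ℝ z.x (z.x + z.s))) :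
    ∀ y ∈ segment ℝ z.x (z.x + z.s), ‖fderiv ℝ (fderiv ℝ (residObj f c z.t)) y -
      fderiv ℝ (fderiv ℝ (residObj f c z.t)) z.x‖ ≤ hessLip L * ‖y - z.x‖ := fun _ hy =>
  norm_fderiv_fderiv_residObj_sub_le hf hc hfL hcL (convex_segment _ _) (left_mem_segment ℝ _ _)
    hy (h.norm_resid.le.trans hε)

/-- The model decreases by at least `lam / 2 * ‖s‖²` and errs by at most `hessLip L * ‖s‖³`, so a
large ratio `lam / ‖s‖` forces the actual decrease to reach `η‖s‖³`. -/
theorem RunInvariant.lam_lt_of_contract (h : RunInvariant P f c L εfeas Δ₀ σ₀ z)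
    (hz : ¬ AtStationary f c z) (hf : ContDiff ℝ 2 f) (hc : ContDiff ℝ 2 c) (hε : εfeas ≤ 1)
    (hfL : LipschitzAlongC2 L f (segment ℝ z.x (z.x + z.s)))
    (hcL : LipschitzAlongC2 L c (segment ℝ z.x (z.x + z.s)))
    (hρ : stepRatio f c z < P.η) : z.lam < ratioBound P L * ‖z.s‖ := by
  have hs := h.norm_pos hz
  rw [stepRatio, decreaseRatio, div_lt_iff₀ (by positivity)] at hρ
  have h1 := (abs_le.mp (abs_sub_quadModel_le (contDiff_residObj hf hc z.t) (hessLip_nonneg L)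
    (h.taylor_hyp hf hc hε hfL hcL))).2
  have h2 := IsTRSolution.model_decrease h.solves
  have h3 : z.lam * ‖z.s‖ ^ 2 < ratioBound P L * ‖z.s‖ * ‖z.s‖ ^ 2 := by
    rw [ratioBound]
    linarith
  exact lt_of_mul_lt_mul_right h3 (by positivity)

/-- At the trial step the gradient of the model is `-lam • s`, of norm at most `σ‖s‖²`; the Taylor
error is of the same order. -/
theorem RunInvariant.norm_gradient_le (h : RunInvariant P f c L εfeas Δ₀ σ₀ z)
    (hf : ContDiff ℝ 2 f) (hc : ContDiff ℝ 2 c) (hε : εfeas ≤ 1)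
    (hfL : LipschitzAlongC2 L f (segment ℝ z.x (z.x + z.s)))
    (hcL : LipschitzAlongC2 L c (segment ℝ z.x (z.x + z.s)))
    (hlam : z.lam ≤ z.σ * ‖z.s‖) :
    ‖∇ (residObj f c z.t) (z.x + z.s)‖ ≤ (sigmaMax P L Δ₀ σ₀ + hessLip L) * ‖z.s‖ ^ 2 := by
  have h1 := norm_gradient_add_sub_le (contDiff_residObj hf hc z.t) (hessLip_nonneg L)
    (h.taylor_hyp hf hc hε hfL hcL)
  have h2 := IsTRSolution.dual h.solves
  have h3 : ∇ (residObj f c z.t) z.x + hess (residObj f c z.t) z.x z.s = -(z.lam • z.s) := by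
    rw [eq_neg_iff_add_eq_zero, add_assoc]
    exact h2
  rw [h3, sub_neg_eq_add] at h1
  have h4 : ‖z.lam • z.s‖ ≤ sigmaMax P L Δ₀ σ₀ * ‖z.s‖ * ‖z.s‖ := by
    rw [norm_smul, Real.norm_of_nonneg (IsTRSolution.lam_nonneg h.solves)]
    have := h.σ_le
    exact mul_le_mul_of_nonneg_right (hlam.trans (by gcongr)) (norm_nonneg _)
  have h5 := norm_sub_le (∇ (residObj f c z.t) (z.x + z.s) + z.lam • z.s) (z.lam • z.s)
  rw [add_sub_cancel_right] at h5
  linarith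

/-- Covers steps accepted only because `‖s‖ = Δ`, where the acceptance rule does not bound the ratio
that enters `σ`. Bounded first and second derivatives limit `lam` for steps of length at least `Δ₀`.
-/
theorem RunInvariant.lam_div_le (h : RunInvariant P f c L εfeas Δ₀ σ₀ z)
    (hz : ¬ AtStationary f c z) (hf : ContDiff ℝ 2 f) (hc : ContDiff ℝ 2 c) (hε : εfeas ≤ 1)
    (hΔ₀ : 0 < Δ₀)
    (hfL : LipschitzAlongC2 L f (segment ℝ z.x (z.x + z.s)))
    (hcL : LipschitzAlongC2 L c (segment ℝ z.x (z.x + z.s))) (hs : Δ₀ ≤ ‖z.s‖) :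
    z.lam / ‖z.s‖ ≤ 2 * L / Δ₀ ^ 2 + 2 * ((L : ℝ) ^ 2 + L) / Δ₀ := by
  have hs0 := h.norm_pos hz
  have hmem := left_mem_segment ℝ z.x (z.x + z.s)
  have h1 := norm_gradient_residObj_le hf hc hfL hcL hmem (h.norm_resid.le.trans hε)
  have h2 : ‖hess (residObj f c z.t) z.x z.s‖ ≤ 2 * ((L : ℝ) ^ 2 + L) * ‖z.s‖ := by
    rw [hess_apply (contDiff_residObj hf hc z.t), (rieszInv N).norm_map]
    exact ContinuousLinearMap.le_of_opNorm_le _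
      (norm_fderiv_fderiv_residObj_le hf hc hfL hcL hmem (h.norm_resid.le.trans hε)) _
  have h3 : z.lam • z.s = -(∇ (residObj f c z.t) z.x + hess (residObj f c z.t) z.x z.s) := by
    rw [eq_neg_iff_add_eq_zero, add_comm, add_assoc]
    exact IsTRSolution.dual h.solves
  have h4 : z.lam * ‖z.s‖ ≤ 2 * L + 2 * ((L : ℝ) ^ 2 + L) * ‖z.s‖ := by
    rw [← Real.norm_of_nonneg (IsTRSolution.lam_nonneg h.solves), ← norm_smul, h3, norm_neg]
    exact (norm_add_le _ _).trans (add_le_add h1 h2)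
  calc z.lam / ‖z.s‖ = z.lam * ‖z.s‖ / ‖z.s‖ ^ 2 := by field_simp
    _ ≤ (2 * L + 2 * ((L : ℝ) ^ 2 + L) * ‖z.s‖) / ‖z.s‖ ^ 2 := by gcongr
    _ = 2 * L / ‖z.s‖ ^ 2 + 2 * ((L : ℝ) ^ 2 + L) / ‖z.s‖ := by field_simp
    _ ≤ _ := by gcongr

/-- The square root in the target update restores exactly the residual lost in the step. The terms
of `sigmaMax` match the sources of growth in `σ`: the initial value, contractions, and accepted
steps of length `Δ`. -/
theorem PhaseStep.runInvariant (hstep : PhaseStep P f c z w)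
    (h : RunInvariant P f c L εfeas Δ₀ σ₀ z)
    (hz : ¬ AtStationary f c z) (hf : ContDiff ℝ 2 f) (hc : ContDiff ℝ 2 c)
    (hε0 : 0 < εfeas) (hε : εfeas ≤ 1) (hΔ₀ : 0 < Δ₀)
    (hfL : LipschitzAlongC2 L f (segment ℝ z.x (z.x + z.s)))
    (hcL : LipschitzAlongC2 L c (segment ℝ z.x (z.x + z.s))) :
    RunInvariant P f c L εfeas Δ₀ σ₀ w := by
  obtain ⟨hw, ⟨ha, hx, ht, hΔ, hδ, hσ⟩ | ⟨hρ, hx, ht, hΔ, hcon, hσ⟩ |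
    ⟨hρ, hna, hx, ht, hΔ, hδ, hσ⟩⟩ := hstep
  · have hs := h.norm_pos hz
    have h1 := h.residual_decrease hz ha.1
    have hη := P.η_pos
    have h2 : 0 ≤ 2 * P.η * ‖z.s‖ ^ 3 := by positivity
    have e : f w.x - w.t = Real.sqrt (εfeas ^ 2 - ‖resid f c (z.x + z.s) z.t‖ ^ 2
        + (f (z.x + z.s) - z.t) ^ 2) := by
      rw [hx, ht, nextTarget, h.norm_resid, sub_sub_cancel]
    refine ⟨hw, ?_, ?_, ?_, ?_, ?_, ?_⟩
    · have e2 : ‖resid f c w.x w.t‖ ^ 2 = εfeas ^ 2 := by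
        rw [norm_sq_resid, e, Real.sq_sqrt (by nlinarith [sq_nonneg (f (z.x + z.s) - z.t)]), hx,
          norm_sq_resid f c (z.x + z.s)]
        ring
      exact (sq_eq_sq₀ (norm_nonneg _) hε0.le).mp e2
    · have := Real.sqrt_nonneg (εfeas ^ 2 - ‖resid f c (z.x + z.s) z.t‖ ^ 2
        + (f (z.x + z.s) - z.t) ^ 2)
      linarith
    · rw [hδ]; exact min_le_left _ _
    · rw [hΔ]; exact h.le_Δ.trans (le_max_left _ _)
    · rw [hσ]; exact h.σlo_le.trans (le_max_left _ _)
    · rw [hσ]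
      refine max_le h.σ_le ?_
      rcases ha.2 with h3 | h3
      · exact ((div_le_iff₀ hs).mpr h3).trans h.σ_le
      · exact (h.lam_div_le hz hf hc hε hΔ₀ hfL hcL (h3 ▸ h.le_Δ)).trans
          ((le_max_right _ _).trans (le_max_right _ _))
  · have hψ := contDiff_residObj hf hc z.t
    have hw' := hw
    rw [SolvesSubproblem, hx, ht] at hw'
    refine ⟨hw, ?_, ?_, ?_, ?_, ?_, ?_⟩
    · rw [hx, ht, h.norm_resid]
    · rw [hx, ht]; exact h.target_le
    · rw [hΔ]
      exact (hcon.radius_le hψ hz h.solves hw').trans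
        ((IsTRSolution.norm_le h.solves).trans h.radius_le)
    · rw [hΔ]; exact h.le_Δ
    · rw [hσ]; exact h.σlo_le.trans (le_max_left _ _)
    · rw [hσ]
      refine max_le h.σ_le ?_
      exact (hcon.le_max_mul hψ hz h.solves hw'
        (h.lam_lt_of_contract hz hf hc hε hfL hcL hρ).le).trans
        ((le_max_left _ _).trans (le_max_right _ _))
  · refine ⟨hw, ?_, ?_, ?_, ?_, ?_, ?_⟩
    · rw [hx, ht, h.norm_resid]
    · rw [hx, ht]; exact h.target_le
    · rw [hδ]; exact min_le_left _ _
    · rw [hΔ]; exact h.le_Δ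
    · rw [hσ]; exact h.σlo_le
    · rw [hσ]; exact h.σ_le

/-- After an expansion the second condition for acceptance holds. -/
theorem RunInvariant.after_expand (h : RunInvariant P f c L εfeas Δ₀ σ₀ z)
    (hf : ContDiff ℝ 2 f) (hc : ContDiff ℝ 2 c)
    (hw : SolvesSubproblem f c w) (hρ : P.η ≤ stepRatio f c z) (hna : ¬ Accepted P f c z)
    (hx : w.x = z.x) (ht : w.t = z.t) (hδ : w.δ = min w.Δ (z.lam / z.σ))
    (hσ : w.σ = z.σ) : w.lam ≤ w.σ * ‖w.s‖ ∨ ‖w.s‖ = w.Δ := by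
  have hψ := contDiff_residObj hf hc z.t
  have hσpos : 0 < z.σ := P.σlo_pos.trans_le h.σlo_le
  have hna' : z.σ * ‖z.s‖ < z.lam ∧ ‖z.s‖ ≠ z.Δ := by
    constructor
    · by_contra hc'
      exact hna ⟨hρ, Or.inl (not_lt.mp hc')⟩
    · exact fun hc' => hna ⟨hρ, Or.inr hc'⟩
  have hlam : 0 < z.lam := (mul_nonneg hσpos.le (norm_nonneg _)).trans_lt hna'.1
  rw [SolvesSubproblem, hx, ht] at hw
  by_contra hcon
  push Not at hcon
  obtain ⟨h1, h2⟩ := hcon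
  rw [hσ] at h1
  have hwlam : 0 < w.lam := (mul_nonneg hσpos.le (norm_nonneg _)).trans_lt h1
  have hwn : ‖w.s‖ = w.δ := hw.norm_eq hwlam
  have h3 : w.δ = z.lam / z.σ := by
    rcases min_choice w.Δ (z.lam / z.σ) with h4 | h4
    · exact absurd (hwn.trans (hδ.trans h4)) h2
    · exact hδ.trans h4
  -- If the condition failed below the cap `Δ`, the multiplier would have grown, so the step could
  -- not be longer than before; yet its length is `z.lam / z.σ > ‖z.s‖`.
  have h5 : z.lam < w.lam := by
    rw [hwn, h3, mul_div_cancel₀ _ hσpos.ne'] at h1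
    exact h1
  have h6 := (hw.isRegSolution hψ).norm_le_of_lt (IsTRSolution.isRegSolution hψ h.solves) h5
  have h7 : ‖z.s‖ < z.lam / z.σ := (lt_div_iff₀ hσpos).mpr (by linarith [hna'.1])
  linarith

end Iteration
/-! ### The decrease of the target in an accepted step -/

section TargetDecrease

/-- The constant in the lower bound for the decrease of the target in an accepted step. -/
def targetDecrease (P : TraceParams) (L : ℝ≥0) (Δ₀ σ₀ : ℝ) : ℝ :=
  min (3 / 8) (min (P.η * Δ₀ ^ 3)
    (P.η * (2 * (sigmaMax P L Δ₀ σ₀ + hessLip L))⁻¹ ^ (3 / 2 : ℝ)))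

theorem sigmaMax_pos (P : TraceParams) (L : ℝ≥0) (Δ₀ σ₀ : ℝ) : 0 < sigmaMax P L Δ₀ σ₀ :=
  (P.σlo_pos.trans_le P.σlo_le_σhi).trans_le
    ((le_max_left _ _).trans ((le_max_left _ _).trans (le_max_right _ _)))

theorem targetDecrease_pos (P : TraceParams) (L : ℝ≥0) {Δ₀ : ℝ} (hΔ₀ : 0 < Δ₀) (σ₀ : ℝ) :
    0 < targetDecrease P L Δ₀ σ₀ := by
  have h1 := sigmaMax_pos P L Δ₀ σ₀
  have h2 := hessLip_nonneg L
  have h3 := P.η_pos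
  refine lt_min (by norm_num) (lt_min (by positivity) (mul_pos h3 (Real.rpow_pos_of_pos ?_ _)))
  positivity

variable {ε εfeas : ℝ}

/-- This is where `ε ≤ εfeas ^ (1/3)` enters: the exponents satisfy `1/3 * 3/2 + 1/2 = 1`. It lets a
decrease of order `εfeas` count as one of the required order. -/
theorem rpow_mul_rpow_le (hε : 0 < ε) (hε0 : 0 < εfeas) (hle : ε ≤ εfeas ^ (1 / 3 : ℝ)) :
    ε ^ (3 / 2 : ℝ) * εfeas ^ (1 / 2 : ℝ) ≤ εfeas := by
  have h1 : ε ^ (3 / 2 : ℝ) ≤ (εfeas ^ (1 / 3 : ℝ)) ^ (3 / 2 : ℝ) :=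
    Real.rpow_le_rpow hε.le hle (by norm_num)
  rw [← Real.rpow_mul hε0.le] at h1
  calc ε ^ (3 / 2 : ℝ) * εfeas ^ (1 / 2 : ℝ)
      ≤ εfeas ^ (1 / 3 * (3 / 2) : ℝ) * εfeas ^ (1 / 2 : ℝ) := by gcongr
    _ = εfeas := by
      rw [← Real.rpow_add hε0]
      norm_num

theorem mul_rpow_three_halves (hε : 0 < ε) (hε0 : 0 < εfeas) :
    (ε * εfeas) ^ (3 / 2 : ℝ) = ε ^ (3 / 2 : ℝ) * εfeas ^ (1 / 2 : ℝ) * εfeas := by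
  rw [Real.mul_rpow hε.le hε0.le, mul_assoc, ← Real.rpow_add_one hε0.ne']
  norm_num

variable {N M : ℕ} {P : TraceParams} {f : EuclideanSpace ℝ (Fin N) → ℝ}
  {c : EuclideanSpace ℝ (Fin N) → EuclideanSpace ℝ (Fin M)} {L : ℝ≥0}
  {Δ₀ σ₀ : ℝ} {z : PhaseState N}

theorem RunInvariant.target_decrease (h : RunInvariant P f c L εfeas Δ₀ σ₀ z)
    (hz : ¬ AtStationary f c z) (hf : ContDiff ℝ 2 f) (hc : ContDiff ℝ 2 c)
    (hε : 0 < ε) (hε0 : 0 < εfeas) (hε1 : εfeas ≤ 1) (hle : ε ≤ εfeas ^ (1 / 3 : ℝ))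
    (hΔ₀ : 0 < Δ₀)
    (hfL : LipschitzAlongC2 L f (segment ℝ z.x (z.x + z.s)))
    (hcL : LipschitzAlongC2 L c (segment ℝ z.x (z.x + z.s)))
    (ha : Accepted P f c z) (ht : ¬ TerminationTest f c ε (z.x + z.s) z.t) :
    targetDecrease P L Δ₀ σ₀ * (ε ^ (3 / 2 : ℝ) * εfeas ^ (1 / 2 : ℝ)) ≤
      z.t - nextTarget f c z := by
  set Y := ε ^ (3 / 2 : ℝ) * εfeas ^ (1 / 2 : ℝ) with hY
  have hY0 : 0 < Y := by positivity
  have hYε : Y ≤ εfeas := rpow_mul_rpow_le hε hε0 hle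
  have hη := P.η_pos
  have hs := h.norm_pos hz
  have hD := h.residual_decrease hz ha.1
  have hs3 : 0 ≤ 2 * P.η * ‖z.s‖ ^ 3 := by positivity
  have hT := h.mul_target_decrease hε0 (by linarith)
  set R := ‖resid f c (z.x + z.s) z.t‖ with hR
  set T := z.t - nextTarget f c z
  have hA : 0 < 2 * (sigmaMax P L Δ₀ σ₀ + hessLip L) := by
    have := sigmaMax_pos P L Δ₀ σ₀
    have := hessLip_nonneg L
    positivity
  have long : ∀ b, 0 ≤ b → b * (Y * εfeas) ≤ ‖z.s‖ ^ 3 → P.η * b * Y ≤ T := fun b _ hb => by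
    have h1 : εfeas * (P.η * b * Y) ≤ εfeas * T := by
      nlinarith [mul_le_mul_of_nonneg_left hb hη.le]
    exact le_of_mul_le_mul_left h1 hε0
  -- Below half, `εfeas² - R² ≥ 3/4 εfeas²`, which gives the constant `3/8`. Above half, the failed
  -- test bounds the gradient below by `ε εfeas / 2`, which is the source of the factor `2` in the
  -- constant.
  rcases le_or_gt R (εfeas / 2) with hRle | hRgt
  · have h1 : R ^ 2 ≤ (εfeas / 2) ^ 2 := pow_le_pow_left₀ (norm_nonneg _) hRle 2
    have h2 : εfeas * (3 / 8 * εfeas) ≤ εfeas * T := by nlinarith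
    calc targetDecrease P L Δ₀ σ₀ * Y ≤ 3 / 8 * εfeas :=
          mul_le_mul (min_le_left _ _) hYε hY0.le (by norm_num)
      _ ≤ T := le_of_mul_le_mul_left h2 hε0
  rcases ha.2 with hlam | hΔ
  · have hRpos : 0 < R := by linarith
    have hg : ε * R < ‖∇ (residObj f c z.t) (z.x + z.s)‖ := by
      by_contra hcon
      exact ht ⟨norm_pos_iff.mp hRpos, not_lt.mp hcon⟩
    have h1 := h.norm_gradient_le hf hc hε1 hfL hcL hlam
    have h2 : (2 * (sigmaMax P L Δ₀ σ₀ + hessLip L))⁻¹ * (ε * εfeas) ≤ ‖z.s‖ ^ 2 := by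
      rw [inv_mul_le_iff₀ hA]
      nlinarith
    have h3 := Real.rpow_le_rpow (by positivity) h2 (show (0 : ℝ) ≤ 3 / 2 by norm_num)
    have e : (‖z.s‖ ^ 2) ^ (3 / 2 : ℝ) = ‖z.s‖ ^ 3 := by
      rw [← Real.rpow_natCast, ← Real.rpow_mul hs.le, ← Real.rpow_natCast]
      norm_num
    rw [Real.mul_rpow (by positivity) (by positivity), mul_rpow_three_halves hε hε0, e] at h3
    refine le_trans ?_ (long _ (by positivity) h3)
    exact mul_le_mul_of_nonneg_right ((min_le_right _ _).trans (min_le_right _ _)) hY0.le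
  · have h1 : Δ₀ ^ 3 ≤ ‖z.s‖ ^ 3 := pow_le_pow_left₀ hΔ₀.le (hΔ ▸ h.le_Δ) 3
    have h2 : Y * εfeas ≤ 1 := mul_le_one₀ (hYε.trans hε1) hε0.le hε1
    refine le_trans ?_ (long (Δ₀ ^ 3) (by positivity) ?_)
    · exact mul_le_mul_of_nonneg_right ((min_le_right _ _).trans (min_le_left _ _)) hY0.le
    · exact (mul_le_of_le_one_right (by positivity) h2).trans h1

end TargetDecrease

/-! ### Counting the iterations -/

section Counting

variable {N M : ℕ} {P : TraceParams} {f : EuclideanSpace ℝ (Fin N) → ℝ}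
  {c : EuclideanSpace ℝ (Fin N) → EuclideanSpace ℝ (Fin M)} {L : ℝ≥0}
  {ε εfeas Δ₀ σ₀ : ℝ} {z w : PhaseState N}

/-- What is known about a state when at most `b` iterations (counting an expansion that is
skipped) have been performed since the last accepted step. -/
def SinceAccept (P : TraceParams) (b : ℕ) (z : PhaseState N) : Prop :=
  b = 0 ∨ (b = 1 ∧ (z.lam ≤ z.σ * ‖z.s‖ ∨ ‖z.s‖ = z.Δ)) ∨
    ∃ i, b = i + 2 ∧ z.lam ≤ z.σ * ‖z.s‖ ∧ P.σlo * P.growth ^ i * ‖z.s‖ ≤ z.lam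

/-- The counter is an upper bound that encodes the phase: `1` after an expansion, `i + 2` once
contractions have forced the ratio up to `σlo * growth ^ i`. It never passes `m + 2`, since a ratio
of at least `σlo * growth ^ m` excludes contraction. -/
theorem SinceAccept.step {b m : ℕ} (hb : SinceAccept P b z) (hbm : b ≤ m + 2)
    (hm : ratioBound P L ≤ P.σlo * P.growth ^ m)
    (hstep : PhaseStep P f c z w) (hna : ¬ Accepted P f c z)
    (h : RunInvariant P f c L εfeas Δ₀ σ₀ z)
    (hz : ¬ AtStationary f c z) (hf : ContDiff ℝ 2 f) (hc : ContDiff ℝ 2 c)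
    (hε : εfeas ≤ 1)
    (hfL : LipschitzAlongC2 L f (segment ℝ z.x (z.x + z.s)))
    (hcL : LipschitzAlongC2 L c (segment ℝ z.x (z.x + z.s))) :
    w.t = z.t ∧ ∃ b', b + 1 ≤ b' ∧ b' ≤ m + 2 ∧ SinceAccept P b' w := by
  obtain ⟨hw, ⟨ha, -⟩ | ⟨hρ, hx, ht, -, hcon, hσ⟩ | ⟨hρ, -, hx, ht, -, hδ, hσ⟩⟩ := hstep
  · exact absurd ha hna
  · refine ⟨ht, ?_⟩
    have hψ := contDiff_residObj hf hc z.t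
    have hw' := hw
    rw [SolvesSubproblem, hx, ht] at hw'
    have hs' : 0 < ‖w.s‖ := norm_pos_iff.mpr (hw'.ne_zero hz)
    have hlow := hcon.σlo_mul_le hψ hz h.solves hw'
    have hup : w.lam ≤ w.σ * ‖w.s‖ := by
      rw [← div_le_iff₀ hs', hσ]
      exact le_max_right _ _
    -- The first contraction sets the counter to `2` whether or not an expansion preceded it.
    rcases hb with rfl | ⟨rfl, -⟩ | ⟨i, rfl, -, hi⟩
    · exact ⟨2, by omega, by omega, Or.inr (Or.inr ⟨0, rfl, hup, by simpa using hlow⟩)⟩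
    · exact ⟨2, by omega, by omega, Or.inr (Or.inr ⟨0, rfl, hup, by simpa using hlow⟩)⟩
    · have hs := h.norm_pos hz
      have hlt := h.lam_lt_of_contract hz hf hc hε hfL hcL hρ
      have h1 : P.σlo * P.growth ^ i < P.σlo * P.growth ^ m :=
        (lt_of_mul_lt_mul_right (hi.trans_lt hlt) hs.le).trans_le hm
      have him : i < m := by
        by_contra hcon'
        have := pow_le_pow_right₀ P.one_lt_growth.le (not_lt.mp hcon')
        exact absurd h1 (not_lt.mpr (mul_le_mul_of_nonneg_left this P.σlo_pos.le))
      refine ⟨i + 3, by omega, by omega, Or.inr (Or.inr ⟨i + 1, rfl, hup, ?_⟩)⟩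
      have h2 := hcon.growth_le hψ hz h.solves hw' (r := P.σlo * P.growth ^ i)
        (le_mul_of_one_le_right P.σlo_pos.le (one_le_pow₀ P.one_lt_growth.le)) hi
      rw [pow_succ]
      linarith
  · refine ⟨ht, ?_⟩
    rcases hb with rfl | ⟨rfl, h1⟩ | ⟨i, rfl, h1, -⟩
    · exact ⟨1, by omega, by omega,
        Or.inr (Or.inl ⟨rfl, h.after_expand hf hc hw hρ hna hx ht hδ hσ⟩)⟩
    · exact absurd ⟨hρ, h1⟩ hna
    · exact absurd ⟨hρ, Or.inl h1⟩ hna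

theorem IsInitial.runInvariant {x₀ : EuclideanSpace ℝ (Fin N)} {δ₀ : ℝ}
    (h : IsInitial f c εfeas x₀ δ₀ Δ₀ σ₀ z) (L : ℝ≥0) (hσ₀ : P.σlo ≤ σ₀) (hε0 : 0 < εfeas)
    (hx₀ : ‖c x₀‖ ≤ εfeas) (hδ₀ : δ₀ ≤ Δ₀) : RunInvariant P f c L εfeas Δ₀ σ₀ z := by
  obtain ⟨hx, ht, hδ, hΔ, hσ, hs⟩ := h
  have h1 : 0 ≤ εfeas ^ 2 - ‖c x₀‖ ^ 2 :=
    sub_nonneg.mpr (pow_le_pow_left₀ (norm_nonneg _) hx₀ 2)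
  refine ⟨hs, ?_, ?_, by rw [hδ, hΔ]; exact hδ₀, hΔ.ge, by rw [hσ]; exact hσ₀, ?_⟩
  · refine (sq_eq_sq₀ (norm_nonneg _) hε0.le).mp ?_
    rw [norm_sq_resid, hx, ht, sub_sub_cancel, Real.sq_sqrt h1]
    ring
  · rw [hx, ht]
    exact sub_le_self _ (Real.sqrt_nonneg _)
  · rw [hσ]
    exact le_max_left _ _

/-- The state after `k` iterations without a stop: `a` of them were accepted steps. -/
theorem IsPhaseRun.counting {x₀ : EuclideanSpace ℝ (Fin N)} {δ₀ : ℝ} {z : ℕ → PhaseState N}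
    (hrun : IsPhaseRun P f c ε εfeas x₀ δ₀ Δ₀ σ₀ z) (hΔ₀ : 0 < Δ₀) (hσ₀ : P.σlo ≤ σ₀)
    (hf : ContDiff ℝ 2 f) (hc : ContDiff ℝ 2 c) (hε : 0 < ε) (hε0 : 0 < εfeas)
    (hε1 : εfeas ≤ 1) (hle : ε ≤ εfeas ^ (1 / 3 : ℝ)) (hx₀ : ‖c x₀‖ ≤ εfeas) (hδ₀ : δ₀ ≤ Δ₀)
    (hL : ∀ k : ℕ, (∀ j < k, ¬ Halts P f c ε (z j)) → ¬ AtStationary f c (z k) →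
      LipschitzAlongC2 L f (segment ℝ (z k).x ((z k).x + (z k).s)) ∧
      LipschitzAlongC2 L c (segment ℝ (z k).x ((z k).x + (z k).s)))
    {m : ℕ} (hm : ratioBound P L ≤ P.σlo * P.growth ^ m) (k : ℕ)
    (hk : ∀ j < k, ¬ Halts P f c ε (z j)) :
    RunInvariant P f c L εfeas Δ₀ σ₀ (z k) ∧ ∃ a b : ℕ, k ≤ (m + 3) * a + b ∧ b ≤ m + 2 ∧
      SinceAccept P b (z k) ∧
      (z k).t + a * (targetDecrease P L Δ₀ σ₀ * (ε ^ (3 / 2 : ℝ) * εfeas ^ (1 / 2 : ℝ))) ≤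
        (z 0).t := by
  induction k with
  | zero => exact ⟨hrun.1.runInvariant L hσ₀ hε0 hx₀ hδ₀, 0, 0, by simp, by simp, Or.inl rfl,
      by simp⟩
  | succ k ih =>
    obtain ⟨hinv, a, b, hkab, hb, hQ, ht⟩ := ih fun j hj => hk j (hj.trans k.lt_succ_self)
    have hstep := hrun.2 k fun j hj => hk j (Nat.lt_succ_of_le hj)
    have hnh := hk k k.lt_succ_self
    have hz : ¬ AtStationary f c (z k) := fun h => hnh (Or.inl h)
    obtain ⟨hfL, hcL⟩ := hL k (fun j hj => hk j (hj.trans k.lt_succ_self)) hz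
    refine ⟨hstep.runInvariant hinv hz hf hc hε0 hε1 hΔ₀ hfL hcL, ?_⟩
    by_cases ha : Accepted P f c (z k)
    · have hT : ¬ TerminationTest f c ε ((z k).x + (z k).s) (z k).t :=
        fun h => hnh (Or.inr ⟨ha, h⟩)
      have hdec := hinv.target_decrease hz hf hc hε hε0 hε1 hle hΔ₀ hfL hcL ha hT
      have hwt : (z (k + 1)).t = nextTarget f c (z k) := by
        rcases hstep.2 with h | h | h
        · exact h.2.2.1
        · exact absurd ha.1 (not_le.mpr h.1)
        · exact absurd ha h.2.1
      -- An accepted step closes a block of at most `m + 3` iterations: the `b ≤ m + 2` counted so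
      -- far and itself.
      refine ⟨a + 1, 0, by rw [mul_add]; omega, by omega, Or.inl rfl, ?_⟩
      rw [hwt]
      push_cast
      linarith
    · obtain ⟨hwt, b', hb1, hb2, hQ'⟩ := hQ.step hb hm hstep ha hinv hz hf hc hε1 hfL hcL
      exact ⟨a, b', by omega, hb2, hQ', by rw [hwt]; exact ht⟩

end Counting

/-! ### The guarantee at the stopping point -/

section Guarantee

variable {N M : ℕ} {P : TraceParams} {f : EuclideanSpace ℝ (Fin N) → ℝ}
  {c : EuclideanSpace ℝ (Fin N) → EuclideanSpace ℝ (Fin M)} {L : ℝ≥0}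
  {ε εfeas Δ₀ σ₀ t : ℝ} {x : EuclideanSpace ℝ (Fin N)} {z : PhaseState N}

theorem gradient_residObj (hf : ContDiff ℝ 2 f) (hc : ContDiff ℝ 2 c)
    (x : EuclideanSpace ℝ (Fin N)) (t : ℝ) :
    ∇ (residObj f c t) x =
      ContinuousLinearMap.adjoint (fderiv ℝ c x) (c x) + (f x - t) • ∇ f x := by
  refine ext_inner_right ℝ fun v => ?_
  rw [inner_gradient, fderiv_residObj hf hc, Pi.add_apply, add_apply,
    fderiv_half_norm_sq_apply hc, fderiv_half_norm_sq_apply (hf.sub contDiff_const),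
    inner_add_left, ContinuousLinearMap.adjoint_inner_left, real_inner_smul_left,
    inner_gradient, fderiv_sub_const]
  simp [mul_comm]

/-- A point that is stationary for the residual relative to the residual norm is an approximate
KKT point or an approximate stationary point of the infeasibility. -/
theorem approxSolution_of_norm_gradient_le (hf : ContDiff ℝ 2 f) (hc : ContDiff ℝ 2 c)
    (hr : resid f c x t ≠ 0) (hle : ‖resid f c x t‖ ≤ εfeas)
    (hg : ‖∇ (residObj f c t) x‖ ≤ ε * ‖resid f c x t‖) : ApproxSolution f c ε εfeas x t := by
  have hcx := (norm_le_norm_resid f c x t).trans hle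
  have hr0 : 0 < ‖resid f c x t‖ := norm_pos_iff.mpr hr
  rw [gradient_residObj hf hc] at hg
  by_cases hft : f x = t
  · have h2 : ‖resid f c x t‖ = ‖c x‖ := by
      refine (sq_eq_sq₀ (norm_nonneg _) (norm_nonneg _)).mp ?_
      rw [norm_sq_resid, hft]
      ring
    rw [h2, hft, sub_self, zero_smul, add_zero] at hg
    rw [h2] at hr0
    exact Or.inr ⟨⟨norm_pos_iff.mp hr0, (div_le_iff₀ hr0).mpr hg⟩, hcx⟩
  · have hd : f x - t ≠ 0 := sub_ne_zero.mpr hft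
    refine Or.inl ⟨⟨hft, _, rfl, ?_⟩, hcx⟩
    -- The residual and its gradient share the factor `f x - t`, which cancels from the relative
    -- bound.
    have e1 : resid f c x t = (f x - t) • (WithLp.toLp 2 ((f x - t)⁻¹ • c x, (1 : ℝ)) :
        WithLp 2 (EuclideanSpace ℝ (Fin M) × ℝ)) := by
      rw [← WithLp.toLp_smul, Prod.smul_mk, smul_inv_smul₀ hd, smul_eq_mul, mul_one, resid]
    have e2 : ContinuousLinearMap.adjoint (fderiv ℝ c x) (c x) + (f x - t) • ∇ f x =
        (f x - t) • (ContinuousLinearMap.adjoint (fderiv ℝ c x) ((f x - t)⁻¹ • c x) + ∇ f x) := by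
      rw [map_smul, smul_add, smul_inv_smul₀ hd]
    have hd' : 0 < ‖f x - t‖ := norm_pos_iff.mpr hd
    rw [e1, e2, norm_smul, norm_smul, mul_left_comm] at hg
    rw [e1, norm_smul] at hr0
    rw [div_le_iff₀ (pos_of_mul_pos_right hr0 hd'.le)]
    exact le_of_mul_le_mul_left hg hd'

theorem RunInvariant.approxSolution_of_atStationary (h : RunInvariant P f c L εfeas Δ₀ σ₀ z)
    (hf : ContDiff ℝ 2 f) (hc : ContDiff ℝ 2 c) (hε : 0 ≤ ε) (hε0 : 0 < εfeas)
    (hz : AtStationary f c z) : ApproxSolution f c ε εfeas z.x z.t := by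
  refine approxSolution_of_norm_gradient_le hf hc ?_ h.norm_resid.le ?_
  · rw [← norm_pos_iff, h.norm_resid]
    exact hε0
  · rw [hz, norm_zero]
    positivity

theorem RunInvariant.approxSolution_of_terminationTest
    (h : RunInvariant P f c L εfeas Δ₀ σ₀ z) (hz : ¬ AtStationary f c z)
    (hf : ContDiff ℝ 2 f) (hc : ContDiff ℝ 2 c) (hε0 : 0 < εfeas) (ha : Accepted P f c z)
    (ht : TerminationTest f c ε (z.x + z.s) z.t) :
    ApproxSolution f c ε εfeas (z.x + z.s) z.t := by
  refine approxSolution_of_norm_gradient_le hf hc ht.1 (le_of_sq_le_sq ?_ hε0.le) ht.2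
  have h1 := h.residual_decrease hz ha.1
  have := P.η_pos
  have h2 : 0 ≤ 2 * P.η * ‖z.s‖ ^ 3 := by positivity
  linarith

end Guarantee
end

theorem mainTheorem4 (P : TraceParams) (L : ℝ≥0) (fmin fmax Δ₀ σ₀ : ℝ)
    (hΔ₀ : 0 < Δ₀) (hσ₀ : P.σlo ≤ σ₀) :
    ∃ C : ℝ, 0 < C ∧
      ∀ (N M : ℕ) (f : EuclideanSpace ℝ (Fin N) → ℝ)
        (c : EuclideanSpace ℝ (Fin N) → EuclideanSpace ℝ (Fin M))
        (ε εfeas δ₀ : ℝ) (x₀ : EuclideanSpace ℝ (Fin N)) (z : ℕ → PhaseState N),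
        ContDiff ℝ 2 f → ContDiff ℝ 2 c →
        0 < ε → 0 < εfeas → εfeas < 1 → ε ≤ εfeas ^ (1 / 3 : ℝ) →
        (∀ x : EuclideanSpace ℝ (Fin N), ‖c x‖ ≤ εfeas → fmin ≤ f x ∧ f x ≤ fmax) →
        ‖c x₀‖ ≤ εfeas → 0 < δ₀ → δ₀ ≤ Δ₀ →
        IsPhaseRun P f c ε εfeas x₀ δ₀ Δ₀ σ₀ z →
        (∀ k : ℕ, (∀ j < k, ¬ Halts P f c ε (z j)) → ¬ AtStationary f c (z k) →
          LipschitzAlongC2 L f (segment ℝ (z k).x ((z k).x + (z k).s)) ∧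
          LipschitzAlongC2 L c (segment ℝ (z k).x ((z k).x + (z k).s))) →
        ∃ k : ℕ, (∀ j < k, ¬ Halts P f c ε (z j)) ∧
          (k + 1 : ℝ) ≤ C * (ε ^ (-(3 / 2) : ℝ) * εfeas ^ (-(1 / 2) : ℝ)) ∧
          ((AtStationary f c (z k) ∧ ApproxSolution f c ε εfeas (z k).x (z k).t) ∨
           (¬ AtStationary f c (z k) ∧ Accepted P f c (z k) ∧
            TerminationTest f c ε ((z k).x + (z k).s) (z k).t ∧
            ApproxSolution f c ε εfeas ((z k).x + (z k).s) (z k).t)) := by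
  obtain ⟨m, hm0⟩ := pow_unbounded_of_one_lt (ratioBound P L / P.σlo) P.one_lt_growth
  have hm : ratioBound P L ≤ P.σlo * P.growth ^ m := by
    rw [div_lt_iff₀ P.σlo_pos] at hm0
    linarith
  have hθ := targetDecrease_pos P L hΔ₀ σ₀
  set θ := targetDecrease P L Δ₀ σ₀ with hθdef
  -- Number of accepted steps times block length `m + 3`, plus the unfinished block. The `+ 1`
  -- beside `|fmax - fmin|` covers the gap `f - t ≤ εfeas < 1`; the absolute value keeps the
  -- constant positive without assuming `fmin ≤ fmax`.
  refine ⟨(m + 3) * ((|fmax - fmin| + 1) / θ + 1) + 1, by positivity, ?_⟩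
  intro N M f c ε εfeas δ₀ x₀ z hf hc hε hε0 hε1 hle hfb hx₀ _ hδ₀ hrun hL
  set Y := ε ^ (3 / 2 : ℝ) * εfeas ^ (1 / 2 : ℝ) with hY
  have hY0 : 0 < Y := by positivity
  have hY1 : Y ≤ 1 := (rpow_mul_rpow_le hε hε0 hle).trans hε1.le
  have hX : ε ^ (-(3 / 2) : ℝ) * εfeas ^ (-(1 / 2) : ℝ) = Y⁻¹ := by
    rw [Real.rpow_neg hε.le, Real.rpow_neg hε0.le, hY, mul_inv]
  rw [hX]
  have hX1 : 1 ≤ Y⁻¹ := (one_le_inv₀ hY0).mpr hY1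
  have hcount := hrun.counting hΔ₀ hσ₀ hf hc hε hε0 hε1.le hle hx₀ hδ₀ hL hm
  have hbound : ∀ k : ℕ, (∀ j < k, ¬ Halts P f c ε (z j)) →
      (k + 1 : ℝ) ≤ ((m + 3) * ((|fmax - fmin| + 1) / θ + 1) + 1) * Y⁻¹ := by
    intro k hk
    obtain ⟨hinv, a, b, hkab, hb, -, ht⟩ := hcount k hk
    have hinv0 := (hcount 0 (by simp)).1
    have h0 : (z 0).t ≤ fmax := hinv0.target_le.trans
      (hfb _ ((norm_le_norm_resid f c _ _).trans hinv0.norm_resid.le)).2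
    have h1 : fmin ≤ f (z k).x :=
      (hfb _ ((norm_le_norm_resid f c _ _).trans hinv.norm_resid.le)).1
    have h2 : f (z k).x - (z k).t ≤ εfeas :=
      (le_abs_self _).trans ((abs_sub_le_norm_resid f c _ _).trans hinv.norm_resid.le)
    have h3 : (a : ℝ) * (θ * Y) ≤ |fmax - fmin| + 1 := by
      have := le_abs_self (fmax - fmin)
      linarith
    have h4 : (a : ℝ) ≤ (|fmax - fmin| + 1) / θ * Y⁻¹ := by
      rw [← le_div_iff₀ (by positivity)] at h3
      calc (a : ℝ) ≤ _ := h3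
        _ = _ := by field_simp
    have h5 : (k : ℝ) ≤ (m + 3) * a + (m + 2) := by
      exact_mod_cast hkab.trans (Nat.add_le_add_left hb _)
    have h6 : (m + 3 : ℝ) * a ≤ (m + 3) * ((|fmax - fmin| + 1) / θ * Y⁻¹) := by gcongr
    have h7 : (m + 4 : ℝ) * 1 ≤ (m + 4) * Y⁻¹ := by gcongr
    linarith
  -- The bound holds for every index not preceded by a stop, so a run that never stops would make
  -- all natural numbers bounded.
  have hex : ∃ k, Halts P f c ε (z k) := by
    by_contra hcon
    push Not at hcon
    obtain ⟨k, hk⟩ := exists_nat_gt (((m + 3) * ((|fmax - fmin| + 1) / θ + 1) + 1) * Y⁻¹)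
    have := hbound k fun j _ => hcon j
    linarith
  classical
  have hmin : ∀ j < Nat.find hex, ¬ Halts P f c ε (z j) := fun j hj => Nat.find_min hex hj
  have hinv := (hcount _ hmin).1
  refine ⟨Nat.find hex, hmin, hbound _ hmin, ?_⟩
  by_cases hz : AtStationary f c (z (Nat.find hex))
  · exact Or.inl ⟨hz, hinv.approxSolution_of_atStationary hf hc hε.le hε0 hz⟩
  · obtain ⟨ha, ht⟩ := (Nat.find_spec hex).resolve_left hz
    exact Or.inr ⟨hz, ha, ht, hinv.approxSolution_of_terminationTest hz hf hc hε0 ha ht⟩
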